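/- For $\tau\in\mathbb H$ and $z\in\mathbb C$ put $q=e^{2\pi i\tau}$, $\zeta=e^{2\pi iz}$, $\log q=2\pi i\tau$, $\log\zeta=2\pi iz$. Let $\mathrm{Li}_3(w)=\sum_{n\ge1}w^n/n^3$, let $B_k$ be the Bernoulli numbers, $\frac{t}{e^t-1}=\sum_{k\ge 0} B_k\frac{t^k}{k!}$, and put $$\mathcal{L}i_3(\zeta,q)=\sum_{n\ge0}\mathrm{Li}_3(q^n\zeta)+\sum_{n\ge1}\mathrm{Li}_3(q^n\zeta^{-1})-\sum_{j=0}^{3}\frac{B_{j+1}}{(3-j)!\,(j+1)!}(\log\zeta)^{3-j}(\log q)^{j}.$$ Let $$f(z,\tau)=\frac1{(2\pi i)^3}\left\{\mathcal{L}i_3(e^{2\pi iz},q)-\mathcal{L}i_3(1,q)\right\},$$ which is given by these series on the strip $0<\operatorname{Im}z<\operatorname{Im}\tau$ and elsewhere by analytic continuation within the set of $(z,\tau)\in\mathbb C\times\mathbb H$ with $z\notin\mathbb Z+\mathbb Z\tau$. A branch of $f$ is an analytic continuation of $f$ from the strip to a connected open subset of this set that contains the strip. Write $f^{(n,m)}=\partial^{n+m}f/\partial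 z^n\partial\tau^m$, and let $E_4(\tau)=1+240\sum_{n\ge1}\sigma_3(n)q^n$ with $\sigma_3(n)=\sum_{d\mid n}d^3$. Let $\tau\in\mathbb H$ and let $x,y\in\mathbb C$ be such that none of $x$, $y$, $x+y$ lies in $\mathbb Z+\mathbb Z\tau$. Then there is a branch of $f$ whose domain contains $(x,\tau)$, $(y,\tau)$ and $(x+y,\tau)$. Moreover, whichever branches of $f$ are used at these three points, the following two identities hold (the argument $\tau$ of $f$ is suppressed): $$f^{(3,0)}(x+y)\big[f^{(2,1)}(x)-f^{(2,1)}(y)\big]+f^{(3,0)}(y)\big[f^{(2,1)}(x+y)-f^{(2,1)}(x)\big]+f^{(1,2)}(x)-\tfrac12f^{(1,2)}(y)+\tfrac12f^{(1,2)}(x+y)=0$$ and $$\begin{aligned}&f^{(3,0)}(x)\big[f^{(1,2)}(x+y)-f^{(1,2)}(y)\big]+f^{(3,0)}(y)\big[f^{(1,2)}(x+y)-f^{(1,2)}(x)\big]-\tfrac23f^{(3,0)}(x+y)\big[f^{(1,2)}(x)+f^{(1,2)}(y)\big]\\&\quad+\tfrac23f^{(2,1)}(x+y)f^{(2,1)}(x)+\tfrac23f^{(2,1)}(x+y)f^{(2,1)}(y)-\tfrac83f^{(2,1)}(x)f^{(2,1)}(y)+\tfrac{10}9f^{(0,3)}(x+y)+\tfrac1{108}E_4(\tau)=0.\end{aligned}$$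 -/

import Mathlib

open scoped UpperHalfPlane

noncomputable section

namespace EllipticTrilog

/-- The polylogarithm series `Li_r(w) = ∑_{n ≥ 1} w ^ n / n ^ r`. -/
def polylog (r : ℕ) (w : ℂ) : ℂ :=
  ∑' n : ℕ, w ^ (n + 1) / ((n : ℂ) + 1) ^ r

/-- The correction term `χ_r(ζ, q)`, a polynomial in `lζ = log ζ` and `lq = log q`.
Here `bernoulli` has generating function `x / (e ^ x - 1)`. -/
def chi (r : ℕ) (lζ lq : ℂ) : ℂ :=
  ∑ j ∈ Finset.range (r + 1),
    ((bernoulli (j + 1) : ℚ) : ℂ) / ((Nat.factorial (r - j) : ℂ) * (Nat.factorial (j + 1) : ℂ))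
      * lζ ^ (r - j) * lq ^ j

/-- The elliptic polylogarithm at `ζ = exp (2πiz)`, `q = exp (2πiτ)`, with `log ζ = 2πiz` and
`log q = 2πiτ`:
`∑_{n ≥ 0} Li_r(q ^ n ζ) + ∑_{n ≥ 1} Li_r(q ^ n ζ⁻¹) - χ_r(ζ, q)`. -/
def ellipticPolylog (r : ℕ) (z τ : ℂ) : ℂ :=
  let ζ : ℂ := Complex.exp (2 * Real.pi * Complex.I * z)
  let q : ℂ := Complex.exp (2 * Real.pi * Complex.I * τ)
  (∑' n : ℕ, polylog r (q ^ n * ζ)) + (∑' n : ℕ, polylog r (q ^ (n + 1) * ζ⁻¹))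
    - chi r (2 * Real.pi * Complex.I * z) (2 * Real.pi * Complex.I * τ)

/-- The function `f(z, τ) = (2πi)⁻³ (𝓛i₃(e ^ (2πiz), q) - 𝓛i₃(1, q))`, given by its defining
series. On the strip `0 < Im z < Im τ` every polylogarithm of an argument involving `z` is
evaluated inside the open unit disc. -/
def fSeries (z τ : ℂ) : ℂ :=
  1 / (2 * Real.pi * Complex.I) ^ 3 * (ellipticPolylog 3 z τ - ellipticPolylog 3 0 τ)

/-- The strip `0 < Im z < Im τ`. -/
def strip : Set (ℂ × ℂ) := {p | 0 < p.1.im ∧ p.1.im < p.2.im}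

/-- The lattice `ℤ + ℤτ`. -/
def lattice (τ : ℂ) : Set ℂ := {z | ∃ m n : ℤ, z = m + n * τ}

/-- All `(z, τ)` with `Im τ > 0` and `z` not in the lattice `ℤ + ℤτ`. -/
def regularSet : Set (ℂ × ℂ) := {p | 0 < p.2.im ∧ p.1 ∉ lattice p.2}

/-- `F` is a branch of `f` on the domain `U`: `U` is a connected open set of pairs `(z, τ)`,
`z` off the lattice, which contains the strip, and `F` is an analytic continuation to `U` of the
defining series of `f` on the strip. -/
structure IsBranch (U : Set (ℂ × ℂ)) (F : ℂ → ℂ → ℂ) : Prop where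
  isOpen : IsOpen U
  isConnected : IsConnected U
  subset_regularSet : U ⊆ regularSet
  strip_subset : strip ⊆ U
  analytic : AnalyticOnNhd ℂ (fun p : ℂ × ℂ => F p.1 p.2) U
  eq_series : ∀ p ∈ strip, F p.1 p.2 = fSeries p.1 p.2

/-- The partial derivative `F^{(n,m)} = ∂^{n+m} F / ∂z^n ∂τ^m`. -/
def pd (F : ℂ → ℂ → ℂ) (n m : ℕ) (z τ : ℂ) : ℂ :=
  iteratedDeriv n (fun z' => iteratedDeriv m (fun τ' => F z' τ') τ) z

end EllipticTrilog

end

open EllipticTrilog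

noncomputable section

namespace EllipticTrilog

/-! ### Bilateral sums of rapidly decaying sequences -/

/-! With $g(w)=e^{2\pi iw}/(1-e^{2\pi iw})$ (`expGeom`), each derivative of $\mathrm{Li}_r(e^{2\pi
iw})$ lowers $r$ by one up to a factor $2\pi i$. Three derivatives of $f$ therefore leave only
series in $g$: up to explicit constants and, for $f^{(0,3)}$, a multiple of $E_4$, $f^{(3-j,j)}$ is
the moment $\sum_{n\in\mathbb Z}n^j a_n$ of $a_n=g(z+n\tau)+[n<0]$ (`bilateralTerm`). These series
are single-valued off the lattice, so the identity theorem forces every branch to have the same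
third derivatives (`IsBranch.pd_eq_of_eqOn_strip`).

The addition law $g(u)g(v)=g(u+v)(1+g(u)+g(v))$ gives a relation between the terms at $x$, $y$ and
$x+y$ (`threeTerm_bilateralTerm`). Multiplying it by $m$, $m^2$ or $mn$ and summing over $\mathbb
Z^2$ gives quadratic relations between moments; the step functions contribute finite power sums,
hence linear terms in the moments. Both identities are linear combinations of these relations.

A branch through given points exists because $\mathrm{Li}_3(e^{2\pi iw})$ extends to the plane cut
along parallel rays below the integers, and the direction of the rays can be chosen to avoid
countably many points. Joint analyticity of the series follows from Osgood's lemma. -/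

/-- The indicator function of the negative integers. -/
def stepNeg (n : ℤ) : ℂ := if n < 0 then 1 else 0

/-- A bilateral sequence that is absolutely summable against every polynomial. -/
def Rapid (a : ℤ → ℂ) : Prop := ∀ k : ℕ, Summable fun n : ℤ => (|(n : ℝ)| + 1) ^ k * ‖a n‖

/-- The moments of a bilateral sequence. -/
def moment (a : ℤ → ℂ) (j : ℕ) : ℂ := ∑' n : ℤ, (n : ℂ) ^ j * a n

lemma Rapid.summable_norm {a : ℤ → ℂ} (ha : Rapid a) (j : ℕ) :
    Summable fun n : ℤ => ‖(n : ℂ) ^ j * a n‖ := by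
  refine Summable.of_nonneg_of_le (fun _ => norm_nonneg _) (fun n => ?_) (ha j)
  rw [norm_mul, norm_pow, Complex.norm_intCast]
  gcongr
  linarith

lemma Rapid.hasSum_moment {a : ℤ → ℂ} (ha : Rapid a) (j : ℕ) :
    HasSum (fun n : ℤ => (n : ℂ) ^ j * a n) (moment a j) :=
  (ha.summable_norm j).of_norm.hasSum

/-- The difference of steps is supported on finitely many $n$: it is $1$ on $[-m,0)$ if $m\ge0$ and
$-1$ on $[0,-m)$ if $m<0$. A discrete antiderivative `Q` gives the signed sum for both signs of `m`,
so polynomial power-sum formulas apply uniformly. -/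
lemma hasSum_stepNeg_sub (p Q : ℤ → ℂ) (h0 : Q 0 = 0) (hs : ∀ m, Q (m + 1) = Q m + p (-m - 1))
    (m : ℤ) : HasSum (fun n => p n * (stepNeg n - stepNeg (m + n))) (Q m) := by
  have key : ∀ m : ℤ, HasSum (fun n => p n * (stepNeg (m + n) - stepNeg (m + 1 + n)))
      (p (-m - 1)) := by
    intro m
    have h := hasSum_ite_eq (-m - 1) (p (-m - 1))
    refine h.congr_fun ?_
    intro n
    unfold stepNeg
    split_ifs <;> first | omega | (subst_vars; simp)
  induction m using Int.induction_on with
  | zero => simp [h0]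
  | succ i ih =>
    rw [hs]
    exact (ih.add (key _)).congr_fun fun n => by ring
  | pred i ih =>
    have h1 := hs (-i - 1)
    have h2 := key (-i - 1)
    rw [sub_add_cancel] at h1 h2
    have : Q (-i - 1) = Q (-i) - p (-(-i - 1) - 1) := by rw [h1]; ring
    rw [this]
    exact (ih.sub h2).congr_fun fun n => by ring

lemma summable_one_div_sq_add_one : Summable fun n : ℤ => 1 / ((n : ℝ) ^ 2 + 1) := by
  have h : Summable fun n : ℤ => 1 / (n : ℝ) ^ 2 := Real.summable_one_div_int_pow.mpr one_lt_two
  refine Summable.of_norm_bounded_eventually h ?_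
  rw [Filter.eventually_cofinite]
  refine Set.Finite.subset (Set.finite_singleton 0) fun n hn => ?_
  by_contra h0
  have h0 : (n : ℝ) ≠ 0 := by simpa using h0
  apply hn
  rw [Real.norm_of_nonneg (by positivity)]
  apply one_div_le_one_div_of_le (by positivity)
  linarith

/-- On the support of the step difference $|n|\le|m|+1$, so $1\le 2(|m|+1)^2/(n^2+1)$. Inserting
this factor bounds the double family by a product of two summable ones. -/
lemma Rapid.summable_step {a : ℤ → ℂ} (ha : Rapid a) (i j : ℕ) (σ : ℤ → ℤ)
    (hσ : ∀ m, |σ m| ≤ |m| + 1) :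
    Summable fun p : ℤ × ℤ => (p.1 : ℂ) ^ i * a p.1 *
      ((p.2 : ℂ) ^ j * (stepNeg p.2 - stepNeg (σ p.1 + p.2))) := by
  have hs : Summable fun p : ℤ × ℤ => (2 * ((|(p.1 : ℝ)| + 1) ^ (i + j + 2) * ‖a p.1‖)) *
      (1 / ((p.2 : ℝ) ^ 2 + 1)) :=
    Summable.mul_of_nonneg (f := fun m : ℤ => 2 * ((|(m : ℝ)| + 1) ^ (i + j + 2) * ‖a m‖))
      (g := fun n : ℤ => 1 / ((n : ℝ) ^ 2 + 1)) ((ha (i + j + 2)).mul_left 2)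
      summable_one_div_sq_add_one
      (fun _ => by dsimp only [Pi.zero_apply]; positivity)
      (fun _ => by dsimp only [Pi.zero_apply]; positivity)
  refine Summable.of_norm_bounded hs ?_
  rintro ⟨m, n⟩
  simp only [norm_mul, norm_pow, Complex.norm_intCast]
  by_cases hz : stepNeg n - stepNeg (σ m + n) = 0
  · rw [hz]; simp; positivity
  have hnm : |n| ≤ |m| + 1 := by
    refine le_trans ?_ (hσ m)
    unfold stepNeg at hz
    split_ifs at hz <;> first | (simp at hz; done) | skip
    all_goals (rw [abs_le]; constructor <;> cases abs_cases (σ m) <;> omega)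
  have hnm' : |(n : ℝ)| ≤ |(m : ℝ)| + 1 := by exact_mod_cast hnm
  have h1 : ‖stepNeg n - stepNeg (σ m + n)‖ ≤ 1 := by
    unfold stepNeg; split_ifs <;> simp
  have hn2 : (n : ℝ) ^ 2 + 1 ≤ 2 * (|(m : ℝ)| + 1) ^ 2 := by
    have h2 : (n : ℝ) ^ 2 ≤ (|(m : ℝ)| + 1) ^ 2 := by
      rw [← sq_abs]; gcongr
    nlinarith [abs_nonneg (m : ℝ)]
  calc |(m : ℝ)| ^ i * ‖a m‖ * (|(n : ℝ)| ^ j * ‖stepNeg n - stepNeg (σ m + n)‖)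
      ≤ (|(m : ℝ)| + 1) ^ i * ‖a m‖ * ((|(m : ℝ)| + 1) ^ j * 1) := by gcongr; linarith
    _ = (|(m : ℝ)| + 1) ^ (i + j) * ‖a m‖ * 1 := by ring
    _ ≤ (|(m : ℝ)| + 1) ^ (i + j) * ‖a m‖ *
        ((2 * (|(m : ℝ)| + 1) ^ 2) * (1 / ((n : ℝ) ^ 2 + 1))) := by
          gcongr
          rw [mul_one_div, le_div_iff₀ (by positivity)]
          linarith
    _ = _ := by ring

/-- Absolute summability allows summing over the second index first, where `Q` evaluates the finite
power sum. -/
lemma Rapid.hasSum_step {a : ℤ → ℂ} (ha : Rapid a) (i j : ℕ) (σ : ℤ → ℤ)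
    (hσ : ∀ m, |σ m| ≤ |m| + 1) (Q : ℤ → ℂ) (h0 : Q 0 = 0)
    (hs : ∀ m : ℤ, Q (m + 1) = Q m + ((-m - 1 : ℤ) : ℂ) ^ j) {T : ℂ}
    (hT : HasSum (fun m : ℤ => (m : ℂ) ^ i * a m * Q (σ m)) T) :
    HasSum (fun p : ℤ × ℤ => (p.1 : ℂ) ^ i * a p.1 *
      ((p.2 : ℂ) ^ j * (stepNeg p.2 - stepNeg (σ p.1 + p.2)))) T := by
  have h := (ha.summable_step i j σ hσ).hasSum
  have h' := h.prod_fiberwise fun m => (hasSum_stepNeg_sub (fun n => (n : ℂ) ^ j) Q h0 hs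
    (σ m)).mul_left ((m : ℂ) ^ i * a m)
  rwa [h'.unique hT] at h

lemma Rapid.hasSum_mul {a b : ℤ → ℂ} (ha : Rapid a) (hb : Rapid b) (i j : ℕ) :
    HasSum (fun p : ℤ × ℤ => ((p.1 : ℂ) ^ i * a p.1) * ((p.2 : ℂ) ^ j * b p.2))
      (moment a i * moment b j) :=
  HasSum.mul (f := fun n : ℤ => (n : ℂ) ^ i * a n) (g := fun n : ℤ => (n : ℂ) ^ j * b n)
    (ha.hasSum_moment i) (hb.hasSum_moment j)
    (summable_mul_of_summable_norm (f := fun n : ℤ => (n : ℂ) ^ i * a n)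
      (g := fun n : ℤ => (n : ℂ) ^ j * b n) (ha.summable_norm i) (hb.summable_norm j))

/-- The automorphism `(m, n) ↦ (m, m + n)` of `ℤ × ℤ`. -/
def shearEquiv : ℤ × ℤ ≃ ℤ × ℤ where
  toFun p := (p.1, p.1 + p.2)
  invFun p := (p.1, p.2 - p.1)
  left_inv p := by simp
  right_inv p := by simp

lemma Rapid.hasSum_mul_left {a w : ℤ → ℂ} (ha : Rapid a) (hw : Rapid w) (i j : ℕ) :
    HasSum (fun p : ℤ × ℤ => ((p.1 : ℂ) ^ i * a p.1) *
      (((p.1 : ℂ) + p.2) ^ j * w (p.1 + p.2))) (moment a i * moment w j) := by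
  have h := shearEquiv.hasSum_iff.mpr (ha.hasSum_mul hw i j)
  exact h.congr_fun fun p => by simp [shearEquiv]

lemma Rapid.hasSum_mul_right {b w : ℤ → ℂ} (hb : Rapid b) (hw : Rapid w) (i j : ℕ) :
    HasSum (fun p : ℤ × ℤ => ((p.2 : ℂ) ^ i * b p.2) *
      (((p.1 : ℂ) + p.2) ^ j * w (p.1 + p.2))) (moment b i * moment w j) := by
  have h := (Equiv.prodComm ℤ ℤ).hasSum_iff.mpr (hb.hasSum_mul_left hw i j)
  exact h.congr_fun fun p => by simp [add_comm]

lemma Rapid.hasSum_step_left {a : ℤ → ℂ} (ha : Rapid a) (i j : ℕ) (Q : ℤ → ℂ) (h0 : Q 0 = 0)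
    (hs : ∀ m : ℤ, Q (m + 1) = Q m + ((-m - 1 : ℤ) : ℂ) ^ j) {T : ℂ}
    (hT : HasSum (fun m : ℤ => (m : ℂ) ^ i * a m * Q m) T) :
    HasSum (fun p : ℤ × ℤ => (p.1 : ℂ) ^ i * a p.1 *
      ((p.2 : ℂ) ^ j * (stepNeg p.2 - stepNeg (p.1 + p.2)))) T :=
  ha.hasSum_step i j id (fun m => by simp) Q h0 hs hT

lemma Rapid.hasSum_step_right {b : ℤ → ℂ} (hb : Rapid b) (i j : ℕ) (Q : ℤ → ℂ) (h0 : Q 0 = 0)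
    (hs : ∀ m : ℤ, Q (m + 1) = Q m + ((-m - 1 : ℤ) : ℂ) ^ j) {T : ℂ}
    (hT : HasSum (fun m : ℤ => (m : ℂ) ^ i * b m * Q m) T) :
    HasSum (fun p : ℤ × ℤ => (p.2 : ℂ) ^ i * b p.2 *
      ((p.1 : ℂ) ^ j * (stepNeg p.1 - stepNeg (p.1 + p.2)))) T := by
  have h := (Equiv.prodComm ℤ ℤ).hasSum_iff.mpr (hb.hasSum_step_left i j Q h0 hs hT)
  exact h.congr_fun fun p => by simp [add_comm]

/-- With $k=m+n$ held fixed, $[n<0]-1=-[m-k-1<0]$, so this is again a step difference, with shift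
$-k-1$. -/
lemma Rapid.hasSum_step_add {w : ℤ → ℂ} (hw : Rapid w) (i j : ℕ) (Q : ℤ → ℂ) (h0 : Q 0 = 0)
    (hs : ∀ m : ℤ, Q (m + 1) = Q m + ((-m - 1 : ℤ) : ℂ) ^ j) {T : ℂ}
    (hT : HasSum (fun k : ℤ => (k : ℂ) ^ i * w k * Q (-k - 1)) T) :
    HasSum (fun p : ℤ × ℤ => ((p.1 : ℂ) + p.2) ^ i * w (p.1 + p.2) *
      ((p.1 : ℂ) ^ j * (stepNeg p.1 + stepNeg p.2 - 1))) T := by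
  have h := hw.hasSum_step i j (fun k => -k - 1)
    (fun m => by cases abs_cases m <;> cases abs_cases (-m - 1) <;> omega) Q h0 hs hT
  have h' := (shearEquiv.trans (Equiv.prodComm ℤ ℤ)).hasSum_iff.mpr h
  refine h'.congr_fun fun p => ?_
  have : stepNeg (-(p.1 + p.2) - 1 + p.1) = 1 - stepNeg p.2 := by
    unfold stepNeg; split_ifs <;> first | omega | simp
  simp only [Function.comp_apply, Equiv.trans_apply, shearEquiv, Equiv.coe_fn_mk,
    Equiv.prodComm_apply, Prod.swap_prod_mk, this]
  push_cast
  ring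

/-! ### Quadratic relations between moments from the three-term relation -/

section Identities

variable {a b w : ℤ → ℂ}

/-- The three-term relation satisfied by the summands of the Kronecker-type series at `x`, `y` and
`x + y`. -/
def ThreeTerm (a b w : ℤ → ℂ) : Prop := ∀ m n : ℤ,
  a m * b n = w (m + n) * (a m + b n) - w (m + n) * (stepNeg m + stepNeg n - 1)
    + a m * (stepNeg n - stepNeg (m + n)) + b n * (stepNeg m - stepNeg (m + n))

lemma ThreeTerm.symm (h : ThreeTerm a b w) : ThreeTerm b a w := fun m n => by
  have := h n m
  rw [add_comm n m] at this
  linear_combination this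

/-- The three-term relation is weighted by $m$ and summed. Against $b_n w_{m+n}$ the weight is
rewritten as $m=(m+n)-n$, so that each double sum factors into moments. -/
lemma ThreeTerm.moment_one_zero (h : ThreeTerm a b w) (ha : Rapid a) (hb : Rapid b)
    (hw : Rapid w) :
    moment a 1 * moment b 0 = moment a 1 * moment w 0 + moment b 0 * moment w 1
      - moment b 1 * moment w 0 + (moment w 2 + moment w 1) / 2 + moment a 2
      - (moment b 2 + moment b 1) / 2 := by
  have h1 := ha.hasSum_mul hb 1 0
  have h2 := ha.hasSum_mul_left hw 1 0
  have h3 := hb.hasSum_mul_right hw 0 1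
  have h4 := hb.hasSum_mul_right hw 1 0
  -- $-m(m+1)/2$ is the discrete antiderivative with increment $-m-1$; below, $m(m+1)(2m+1)/6$ plays
  -- this role for $(-m-1)^2$.
  have h5 := hw.hasSum_step_add 0 1 (fun m => -(m * (m + 1) / 2)) (by simp)
    (fun m => by push_cast; ring)
    (((hw.hasSum_moment 2).add (hw.hasSum_moment 1)).mul_left (-1 / 2) |>.congr_fun
      fun k => by push_cast; ring)
  have h6 := ha.hasSum_step_left 1 0 (fun m => m) (by simp) (fun m => by push_cast; ring)
    ((ha.hasSum_moment 2).congr_fun fun k => by ring)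
  have h7 := hb.hasSum_step_right 0 1 (fun m => -(m * (m + 1) / 2)) (by simp)
    (fun m => by push_cast; ring)
    (((hb.hasSum_moment 2).add (hb.hasSum_moment 1)).mul_left (-1 / 2) |>.congr_fun
      fun k => by ring)
  have h8 := ((((h2.add h3).sub h4).sub h5).add h6).add h7
  have h9 := h1.unique (h8.congr_fun fun p => by linear_combination (p.1 : ℂ) * h p.1 p.2)
  linear_combination h9

lemma ThreeTerm.moment_two_zero (h : ThreeTerm a b w) (ha : Rapid a) (hb : Rapid b)
    (hw : Rapid w) :
    moment a 2 * moment b 0 = moment a 2 * moment w 0 + moment b 0 * moment w 2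
      - 2 * (moment b 1 * moment w 1) + moment b 2 * moment w 0
      + (2 * moment w 3 + 3 * moment w 2 + moment w 1) / 6 + moment a 3
      + (2 * moment b 3 + 3 * moment b 2 + moment b 1) / 6 := by
  have h1 := ha.hasSum_mul hb 2 0
  have h2 := ha.hasSum_mul_left hw 2 0
  have h3 := hb.hasSum_mul_right hw 0 2
  have h4 := (hb.hasSum_mul_right hw 1 1).mul_left 2
  have h4' := hb.hasSum_mul_right hw 2 0
  have h5 := hw.hasSum_step_add 0 2 (fun m => m * (m + 1) * (2 * m + 1) / 6) (by simp)
    (fun m => by push_cast; ring)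
    ((((hw.hasSum_moment 3).mul_left 2).add ((hw.hasSum_moment 2).mul_left 3)).add
      (hw.hasSum_moment 1) |>.mul_left (-1 / 6) |>.congr_fun fun k => by push_cast; ring)
  have h6 := ha.hasSum_step_left 2 0 (fun m => m) (by simp) (fun m => by push_cast; ring)
    ((ha.hasSum_moment 3).congr_fun fun k => by ring)
  have h7 := hb.hasSum_step_right 0 2 (fun m => m * (m + 1) * (2 * m + 1) / 6) (by simp)
    (fun m => by push_cast; ring)
    ((((hb.hasSum_moment 3).mul_left 2).add ((hb.hasSum_moment 2).mul_left 3)).add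
      (hb.hasSum_moment 1) |>.mul_left (1 / 6) |>.congr_fun fun k => by ring)
  have h8 := (((((h2.add h3).sub h4).add h4').sub h5).add h6).add h7
  have h9 := h1.unique (h8.congr_fun fun p => by linear_combination (p.1 : ℂ) ^ 2 * h p.1 p.2)
  linear_combination h9

/-- The weight is $mn$, written as $m(m+n)-m^2$ or $n(m+n)-n^2$ according to which of $a_m$, $b_n$
multiplies $w_{m+n}$. -/
lemma ThreeTerm.moment_one_one (h : ThreeTerm a b w) (ha : Rapid a) (hb : Rapid b)
    (hw : Rapid w) :
    moment a 1 * moment b 1 = moment a 1 * moment w 1 - moment a 2 * moment w 0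
      + moment b 1 * moment w 1 - moment b 2 * moment w 0
      + (moment w 3 - moment w 1) / 6 - (moment a 3 + moment a 2) / 2
      - (moment b 3 + moment b 2) / 2 := by
  have h1 := ha.hasSum_mul hb 1 1
  have h2 := ha.hasSum_mul_left hw 1 1
  have h2' := ha.hasSum_mul_left hw 2 0
  have h3 := hb.hasSum_mul_right hw 1 1
  have h3' := hb.hasSum_mul_right hw 2 0
  have h5 := hw.hasSum_step_add 1 1 (fun m => -(m * (m + 1) / 2)) (by simp)
    (fun m => by push_cast; ring)
    (((hw.hasSum_moment 3).add (hw.hasSum_moment 2)).mul_left (-1 / 2) |>.congr_fun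
      fun k => by push_cast; ring)
  have h5' := hw.hasSum_step_add 0 2 (fun m => m * (m + 1) * (2 * m + 1) / 6) (by simp)
    (fun m => by push_cast; ring)
    ((((hw.hasSum_moment 3).mul_left 2).add ((hw.hasSum_moment 2).mul_left 3)).add
      (hw.hasSum_moment 1) |>.mul_left (-1 / 6) |>.congr_fun fun k => by push_cast; ring)
  have h6 := ha.hasSum_step_left 1 1 (fun m => -(m * (m + 1) / 2)) (by simp)
    (fun m => by push_cast; ring)
    (((ha.hasSum_moment 3).add (ha.hasSum_moment 2)).mul_left (-1 / 2) |>.congr_fun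
      fun k => by ring)
  have h7 := hb.hasSum_step_right 1 1 (fun m => -(m * (m + 1) / 2)) (by simp)
    (fun m => by push_cast; ring)
    (((hb.hasSum_moment 3).add (hb.hasSum_moment 2)).mul_left (-1 / 2) |>.congr_fun
      fun k => by ring)
  have h8 := ((((h2.sub h2').add (h3.sub h3')).sub (h5.sub h5')).add h6).add h7
  have h9 := h1.unique (h8.congr_fun fun p => by
    linear_combination (p.1 : ℂ) * p.2 * h p.1 p.2)
  linear_combination h9

lemma ThreeTerm.first_identity (h : ThreeTerm a b w) (ha : Rapid a) (hb : Rapid b)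
    (hw : Rapid w) :
    (1 / 2 + moment w 0) * ((-1 / 12 + moment a 1) - (-1 / 12 + moment b 1))
      + (1 / 2 + moment b 0) * ((-1 / 12 + moment w 1) - (-1 / 12 + moment a 1))
      + (moment a 2 - 1 / 2 * moment b 2 + 1 / 2 * moment w 2) = 0 := by
  linear_combination -h.moment_one_zero ha hb hw

/-- The weights $m^2$ and $n^2$ together give the third moments of `a` and `b` the coefficient
$1+\tfrac13=\tfrac43$, while $mn$ gives them $-\tfrac12$. The factor $\tfrac83$ removes them and
leaves $\tfrac23+\tfrac49=\tfrac{10}9$ on the third moment of `w`. -/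
lemma ThreeTerm.second_identity (h : ThreeTerm a b w) (ha : Rapid a) (hb : Rapid b)
    (hw : Rapid w) :
    ((1 / 2 + moment a 0) * (moment w 2 - moment b 2)
        + (1 / 2 + moment b 0) * (moment w 2 - moment a 2)
        - 2 / 3 * ((1 / 2 + moment w 0) * (moment a 2 + moment b 2)))
      + (2 / 3 * ((-1 / 12 + moment w 1) * (-1 / 12 + moment a 1))
        + 2 / 3 * ((-1 / 12 + moment w 1) * (-1 / 12 + moment b 1))
        - 8 / 3 * ((-1 / 12 + moment a 1) * (-1 / 12 + moment b 1)))
      + 10 / 9 * moment w 3 + 1 / 108 = 0 := by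
  linear_combination -h.moment_two_zero ha hb hw - h.symm.moment_two_zero hb ha hw
    - 8 / 3 * h.moment_one_one ha hb hw

end Identities

/-! ### Osgood's lemma in two variables -/

section Osgood

open Metric Set Filter Topology
open scoped Real

/-- The compact parameter square `[0, 2π]²` of the distinguished boundary of a bidisc. -/
abbrev ParamSquare : Type := Icc (0 : ℝ) (2 * π) × Icc (0 : ℝ) (2 * π)

/-- The Cauchy kernel `1 / (γ - z)` as an element of a Banach algebra. -/
def cauchyKernel (γ : C(ParamSquare, ℂ)) (z : ℂ) : C(ParamSquare, ℂ) :=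
  Ring.inverse (γ - algebraMap ℂ C(ParamSquare, ℂ) z)

lemma isUnit_sub_algebraMap {γ : C(ParamSquare, ℂ)} {z : ℂ} (h : ∀ x, γ x ≠ z) :
    IsUnit (γ - algebraMap ℂ C(ParamSquare, ℂ) z) := by
  rw [ContinuousMap.isUnit_iff_forall_ne_zero]
  intro x
  simpa [sub_eq_zero] using h x

/-- Inversion is analytic at the units of a Banach algebra, so the kernel is analytic as a function
with values in $C([0,2\pi]^2)$; no expansion under the integral sign is needed. -/
lemma analyticAt_cauchyKernel {γ : C(ParamSquare, ℂ)} {z : ℂ} (h : ∀ x, γ x ≠ z) :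
    AnalyticAt ℂ (cauchyKernel γ) z := by
  obtain ⟨u, hu⟩ := isUnit_sub_algebraMap h
  have h1 : AnalyticAt ℂ Ring.inverse (γ - algebraMap ℂ C(ParamSquare, ℂ) z) := by
    rw [← hu]; exact analyticAt_inverse u
  have h2 : AnalyticAt ℂ (fun z => γ - algebraMap ℂ C(ParamSquare, ℂ) z) z :=
    analyticAt_const.sub ((Algebra.linearMap ℂ C(ParamSquare, ℂ)).toContinuousLinearMap.analyticAt z)
  exact AnalyticAt.fun_comp (f := fun z => γ - algebraMap ℂ C(ParamSquare, ℂ) z) h1 h2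

lemma cauchyKernel_apply {γ : C(ParamSquare, ℂ)} {z : ℂ} (h : ∀ x, γ x ≠ z) (x : ParamSquare) :
    cauchyKernel γ z x = (γ x - z)⁻¹ := by
  have h1 := Ring.mul_inverse_cancel _ (isUnit_sub_algebraMap h)
  have h2 := DFunLike.congr_fun h1 x
  have h3 : γ x - z ≠ 0 := sub_ne_zero.mpr (h x)
  have h4 : (γ x - z) * cauchyKernel γ z x = 1 := by simpa [cauchyKernel] using h2
  field_simp
  linear_combination h4

/-- Integration over `[0, 2π]²` against a continuous weight, as a functional on continuous
functions. -/
def weightedIntegral (W : ℝ → ℝ → ℂ) (hW : Continuous (Function.uncurry W)) :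
    C(ParamSquare, ℂ) →L[ℂ] ℂ := by
  have hpi : (0 : ℝ) ≤ 2 * π := by positivity
  let J : C(ParamSquare, ℂ) → ℝ → ℝ → ℂ := fun G θ φ =>
    W θ φ * G (projIcc 0 (2 * π) hpi θ, projIcc 0 (2 * π) hpi φ)
  have hJ : ∀ G, Continuous (Function.uncurry (J G)) := fun G =>
    hW.mul (G.continuous.comp ((continuous_projIcc.comp continuous_fst).prodMk
      (continuous_projIcc.comp continuous_snd)))
  have hJ1 : ∀ G θ, Continuous (J G θ) := fun G θ => (hJ G).comp (by fun_prop : Continuous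
    fun φ : ℝ => (θ, φ))
  have hJ2 : ∀ G, Continuous fun θ => ∫ φ in (0 : ℝ)..2 * π, J G θ φ := fun G =>
    intervalIntegral.continuous_parametric_intervalIntegral_of_continuous (hJ G)
      continuous_const
  refine LinearMap.mkContinuousOfExistsBound
    { toFun := fun G => ∫ θ in (0 : ℝ)..2 * π, ∫ φ in (0 : ℝ)..2 * π, J G θ φ
      map_add' := fun G H => ?_
      map_smul' := fun c G => ?_ } ?_
  · rw [← intervalIntegral.integral_add ((hJ2 G).intervalIntegrable _ _)
      ((hJ2 H).intervalIntegrable _ _)]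
    congr 1; ext θ
    rw [← intervalIntegral.integral_add ((hJ1 G θ).intervalIntegrable _ _)
      ((hJ1 H θ).intervalIntegrable _ _)]
    congr 1; ext φ
    simp [J, mul_add]
  · simp only [RingHom.id_apply, smul_eq_mul, ← intervalIntegral.integral_const_mul]
    congr 1; ext θ; congr 1; ext φ
    simp [J]; ring
  · obtain ⟨M, hM⟩ := ((isCompact_Icc (a := (0 : ℝ)) (b := 2 * π)).prod
      (isCompact_Icc (a := (0 : ℝ)) (b := 2 * π))).exists_bound_of_continuousOn hW.continuousOn
    refine ⟨M * |2 * π - 0| * |2 * π - 0|, fun G => ?_⟩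
    have : M * |2 * π - 0| * |2 * π - 0| * ‖G‖ = M * ‖G‖ * |2 * π - 0| * |2 * π - 0| := by ring
    rw [this]
    refine intervalIntegral.norm_integral_le_of_norm_le_const fun θ hθ => ?_
    refine intervalIntegral.norm_integral_le_of_norm_le_const fun φ hφ => ?_
    rw [uIoc_of_le hpi] at hθ hφ
    have h1 : ‖W θ φ‖ ≤ M := hM (θ, φ) ⟨Ioc_subset_Icc_self hθ, Ioc_subset_Icc_self hφ⟩
    rw [norm_mul]
    exact mul_le_mul h1 (G.norm_coe_le_norm _) (norm_nonneg _) ((norm_nonneg _).trans h1)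

lemma weightedIntegral_apply (W : ℝ → ℝ → ℂ) (hW : Continuous (Function.uncurry W))
    (G : C(ParamSquare, ℂ)) (g : ℝ → ℝ → ℂ) (hg : ∀ x : ParamSquare, G x = g x.1 x.2) :
    weightedIntegral W hW G = ∫ θ in (0 : ℝ)..2 * π, ∫ φ in (0 : ℝ)..2 * π, W θ φ * g θ φ := by
  have hpi : (0 : ℝ) ≤ 2 * π := by positivity
  refine intervalIntegral.integral_congr fun θ hθ => ?_
  refine intervalIntegral.integral_congr fun φ hφ => ?_
  rw [uIcc_of_le hpi] at hθ hφ
  simp only [hg, projIcc_of_mem hpi hθ, projIcc_of_mem hpi hφ]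

/-- **Osgood's lemma** on a bidisc: a continuous function of two complex variables that is
holomorphic in each variable separately is analytic at the centre. -/
theorem analyticAt_of_separately_differentiableOn {F : ℂ × ℂ → ℂ} {a b : ℂ} {R : ℝ} (hR : 0 < R)
    (hc : ContinuousOn F (closedBall a R ×ˢ closedBall b R))
    (h1 : ∀ t ∈ closedBall b R, DifferentiableOn ℂ (fun z => F (z, t)) (closedBall a R))
    (h2 : ∀ z ∈ closedBall a R, DifferentiableOn ℂ (fun t => F (z, t)) (closedBall b R)) :
    AnalyticAt ℂ F (a, b) := by
  let γ₁ : C(ParamSquare, ℂ) := ⟨fun x => circleMap a R x.1, by fun_prop⟩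
  let γ₂ : C(ParamSquare, ℂ) := ⟨fun x => circleMap b R x.2, by fun_prop⟩
  have hγ₁ : ∀ z ∈ ball a R, ∀ x, γ₁ x ≠ z := fun z hz x => circleMap_ne_mem_ball hz _
  have hγ₂ : ∀ z ∈ ball b R, ∀ x, γ₂ x ≠ z := fun z hz x => circleMap_ne_mem_ball hz _
  let W : ℝ → ℝ → ℂ := fun θ φ => deriv (circleMap a R) θ * deriv (circleMap b R) φ *
    F (circleMap a R θ, circleMap b R φ)
  have hW : Continuous (Function.uncurry W) := by
    refine Continuous.mul ?_ (hc.comp_continuous (by fun_prop) fun x =>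
      ⟨circleMap_mem_closedBall _ hR.le _, circleMap_mem_closedBall _ hR.le _⟩)
    simp only [deriv_circleMap]
    fun_prop
  -- Cauchy's formula in each variable writes $F(z,t)$ as a fixed continuous functional applied to
  -- the product of the two kernels, which makes the dependence on $(z,t)$ jointly analytic.
  have key : ∀ z ∈ ball a R, ∀ t ∈ ball b R, weightedIntegral W hW
      (cauchyKernel γ₁ z * cauchyKernel γ₂ t) = (2 * π * Complex.I) ^ 2 * F (z, t) := by
    intro z hz t ht
    rw [weightedIntegral_apply W hW _
      (fun θ φ => (circleMap a R θ - z)⁻¹ * (circleMap b R φ - t)⁻¹)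
      (fun x => by simp [cauchyKernel_apply (hγ₁ z hz), cauchyKernel_apply (hγ₂ t ht), γ₁, γ₂])]
    have e1 : ∀ w ∈ closedBall a R, (∫ φ in (0 : ℝ)..2 * π, deriv (circleMap b R) φ *
        ((circleMap b R φ - t)⁻¹ * F (w, circleMap b R φ))) = 2 * π * Complex.I * F (w, t) :=
      fun w hw => by
        simpa [circleIntegral, smul_eq_mul] using (h2 w hw).circleIntegral_sub_inv_smul ht
    have e2 : (∫ θ in (0 : ℝ)..2 * π, deriv (circleMap a R) θ *
        ((circleMap a R θ - z)⁻¹ * F (circleMap a R θ, t))) = 2 * π * Complex.I * F (z, t) := by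
      simpa [circleIntegral, smul_eq_mul] using
        (h1 t (ball_subset_closedBall ht)).circleIntegral_sub_inv_smul hz
    rw [sq, mul_assoc, ← e2, ← intervalIntegral.integral_const_mul]
    congr 1; ext θ
    have e3 := e1 _ (circleMap_mem_closedBall a hR.le θ)
    calc _ = ∫ φ in (0 : ℝ)..2 * π, (deriv (circleMap a R) θ * (circleMap a R θ - z)⁻¹) *
          (deriv (circleMap b R) φ * ((circleMap b R φ - t)⁻¹ *
            F (circleMap a R θ, circleMap b R φ))) := by
          congr 1; ext φ; simp only [W]; ring
      _ = _ := by rw [intervalIntegral.integral_const_mul, e3]; ring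
  have hana : AnalyticAt ℂ (fun p : ℂ × ℂ => ((2 * π * Complex.I) ^ 2)⁻¹ *
      weightedIntegral W hW (cauchyKernel γ₁ p.1 * cauchyKernel γ₂ p.2)) (a, b) := by
    have k1 : AnalyticAt ℂ (fun p : ℂ × ℂ => cauchyKernel γ₁ p.1) (a, b) :=
      AnalyticAt.fun_comp (g := cauchyKernel γ₁) (f := Prod.fst)
        (analyticAt_cauchyKernel (hγ₁ a (mem_ball_self hR))) analyticAt_fst
    have k2 : AnalyticAt ℂ (fun p : ℂ × ℂ => cauchyKernel γ₂ p.2) (a, b) :=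
      AnalyticAt.fun_comp (g := cauchyKernel γ₂) (f := Prod.snd)
        (analyticAt_cauchyKernel (hγ₂ b (mem_ball_self hR))) analyticAt_snd
    exact analyticAt_const.mul (((weightedIntegral W hW).analyticAt _).fun_comp (k1.mul k2))
  refine hana.congr ?_
  filter_upwards [prod_mem_nhds (ball_mem_nhds a hR) (ball_mem_nhds b hR)] with p hp
  rw [key p.1 hp.1 p.2 hp.2, inv_mul_cancel_left₀]
  exact pow_ne_zero _ Complex.two_pi_I_ne_zero

/-- A locally normally convergent series of analytic functions of two variables is analytic. -/
theorem analyticAt_tsum_of_summable_norm {f : ℕ → ℂ × ℂ → ℂ} {p : ℂ × ℂ} {u : ℕ → ℝ}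
    (hu : Summable u) (h : ∀ᶠ x in 𝓝 p, ∀ n, AnalyticAt ℂ (f n) x ∧ ‖f n x‖ ≤ u n) :
    AnalyticAt ℂ (fun x => ∑' n, f n x) p := by
  obtain ⟨R, hR, hb⟩ := Metric.nhds_basis_ball.eventually_iff.mp h
  obtain ⟨a, b⟩ := p
  have hs : ∀ z ∈ ball a R, ∀ t ∈ ball b R, (z, t) ∈ ball (a, b) R := fun z hz t ht => by
    rw [← ball_prod_same]; exact ⟨hz, ht⟩
  have hc2 : ∀ c : ℂ, closedBall c (R / 2) ⊆ ball c R :=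
    fun c => closedBall_subset_ball (by linarith)
  refine analyticAt_of_separately_differentiableOn (half_pos hR) ?_ ?_ ?_
  · refine (continuousOn_tsum (s := ball (a, b) R) (fun n x hx =>
      ((hb hx n).1.continuousAt).continuousWithinAt) hu fun n x hx => (hb hx n).2).mono ?_
    rintro ⟨z, t⟩ ⟨hz, ht⟩
    exact hs z (hc2 _ hz) t (hc2 _ ht)
  · intro t ht
    refine (Complex.differentiableOn_tsum_of_summable_norm hu (F := fun n z => f n (z, t))
      (fun n z hz => ?_) isOpen_ball fun n z hz => (hb (hs z hz t (hc2 _ ht)) n).2).mono (hc2 a)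
    exact ((hb (hs z hz t (hc2 _ ht)) n).1.differentiableAt.comp z
      (by fun_prop : DifferentiableAt ℂ (fun z : ℂ => (z, t)) z)).differentiableWithinAt
  · intro z hz
    refine (Complex.differentiableOn_tsum_of_summable_norm hu (F := fun n t => f n (z, t))
      (fun n t ht => ?_) isOpen_ball fun n t ht => (hb (hs z (hc2 _ hz) t ht) n).2).mono (hc2 b)
    exact ((hb (hs z (hc2 _ hz) t ht) n).1.differentiableAt.comp t
      (by fun_prop : DifferentiableAt ℂ (fun t : ℂ => (z, t)) t)).differentiableWithinAt

end Osgood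

/-! ### Series over the points `(n + 1)τ - z` -/

section LatticeSeries

open Metric Set Filter Topology

/-- The series `∑_{n ≥ 1} n ^ j h(nτ - z)`. -/
def latSeries (h : ℂ → ℂ) (j : ℕ) (z τ : ℂ) : ℂ :=
  ∑' n : ℕ, ((n : ℂ) + 1) ^ j * h (((n : ℂ) + 1) * τ - z)

/-- A holomorphic function on an open set containing the upper half plane which decays
exponentially at `i∞`. -/
structure UpperDecay (h : ℂ → ℂ) (D : Set ℂ) : Prop where
  isOpen : IsOpen D
  upper : ∀ w : ℂ, 0 < w.im → w ∈ D
  diff : DifferentiableOn ℂ h D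
  decay : ∃ C : ℝ, ∀ w : ℂ, 1 ≤ w.im → ‖h w‖ ≤ C * Real.exp (-w.im)

/-- The set of `(z, τ)` with `Im τ > 0` for which all points `nτ - z`, `n ≥ 1`, lie in `D`. -/
def latDomain (D : Set ℂ) : Set (ℂ × ℂ) :=
  {p | 0 < p.2.im ∧ ∀ n : ℕ, ((n : ℂ) + 1) * p.2 - p.1 ∈ D}

lemma im_mul_sub (n : ℕ) (p : ℂ × ℂ) :
    (((n : ℂ) + 1) * p.2 - p.1).im = ((n : ℝ) + 1) * p.2.im - p.1.im := by
  simp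

/-- One `N` serves a whole neighbourhood: beyond it all points lie where exponential decay holds, so
only finitely many terms need individual control. -/
lemma eventually_one_le_im {p : ℂ × ℂ} (hp : 0 < p.2.im) :
    ∃ N : ℕ, ∀ᶠ x in 𝓝 p, p.2.im / 2 < x.2.im ∧ x.1.im < p.1.im + 1 ∧
      ∀ n ≥ N, 1 ≤ (((n : ℂ) + 1) * x.2 - x.1).im := by
  obtain ⟨N, hN⟩ := exists_nat_gt ((p.1.im + 2) / (p.2.im / 2))
  refine ⟨N, ?_⟩
  have h1 : ∀ᶠ x : ℂ × ℂ in 𝓝 p, p.2.im / 2 < x.2.im :=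
    (Complex.continuous_im.comp continuous_snd).continuousAt.eventually
      (lt_mem_nhds (by simp only [Function.comp_apply]; linarith))
  have h2 : ∀ᶠ x : ℂ × ℂ in 𝓝 p, x.1.im < p.1.im + 1 :=
    (Complex.continuous_im.comp continuous_fst).continuousAt.eventually
      (gt_mem_nhds (by simp only [Function.comp_apply]; linarith))
  filter_upwards [h1, h2] with x hx1 hx2
  refine ⟨hx1, hx2, fun n hn => ?_⟩
  rw [im_mul_sub]
  rw [div_lt_iff₀ (by linarith)] at hN
  have hn' : (N : ℝ) ≤ n := by exact_mod_cast hn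
  nlinarith

lemma isOpen_latDomain {D : Set ℂ} (hD : IsOpen D) (hup : ∀ w : ℂ, 0 < w.im → w ∈ D) :
    IsOpen (latDomain D) := by
  rw [isOpen_iff_mem_nhds]
  intro p hp
  obtain ⟨N, hN⟩ := eventually_one_le_im hp.1
  have hfin : ∀ᶠ x : ℂ × ℂ in 𝓝 p, ∀ n ∈ Finset.range N, ((n : ℂ) + 1) * x.2 - x.1 ∈ D := by
    rw [Filter.eventually_all_finset]
    intro n _
    exact (by fun_prop : Continuous fun x : ℂ × ℂ => ((n : ℂ) + 1) * x.2 - x.1).continuousAt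
      (hD.mem_nhds (hp.2 n))
  filter_upwards [hN, hfin] with x hx hx'
  refine ⟨by linarith [hx.1, hp.1], fun n => ?_⟩
  by_cases hn : n < N
  · exact hx' n (Finset.mem_range.mpr hn)
  · exact hup _ (by linarith [hx.2.2 n (not_lt.mp hn)])

variable {h h' : ℂ → ℂ} {D : Set ℂ}

lemma UpperDecay.analyticAt_term (H : UpperDecay h D) (j n : ℕ) {x : ℂ × ℂ}
    (hx : x ∈ latDomain D) :
    AnalyticAt ℂ (fun x : ℂ × ℂ => ((n : ℂ) + 1) ^ j * h (((n : ℂ) + 1) * x.2 - x.1)) x := by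
  refine analyticAt_const.mul ?_
  have h1 : AnalyticAt ℂ h (((n : ℂ) + 1) * x.2 - x.1) :=
    H.diff.analyticAt (H.isOpen.mem_nhds (hx.2 n))
  exact AnalyticAt.fun_comp (g := h) (f := fun x : ℂ × ℂ => ((n : ℂ) + 1) * x.2 - x.1) h1
    ((analyticAt_const.mul analyticAt_snd).sub analyticAt_fst)

/-- The majorant is a polynomial times a geometric sequence for the tail, and for the first `N`
terms their value at `p` plus one, by continuity. -/
lemma UpperDecay.eventually_norm_term_le (H : UpperDecay h D) (j : ℕ) {p : ℂ × ℂ}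
    (hp : p ∈ latDomain D) :
    ∃ u : ℕ → ℝ, Summable u ∧ ∀ᶠ x in 𝓝 p, x ∈ latDomain D ∧ ∀ n : ℕ,
      ‖((n : ℂ) + 1) ^ j * h (((n : ℂ) + 1) * x.2 - x.1)‖ ≤ u n := by
  obtain ⟨C, hC⟩ := H.decay
  obtain ⟨N, hN⟩ := eventually_one_le_im hp.1
  have hC0 : 0 ≤ C := by
    have := (norm_nonneg _).trans (hC Complex.I (by simp))
    exact nonneg_of_mul_nonneg_left this (Real.exp_pos _)
  let v : ℕ → ℝ := fun n => C * Real.exp (p.1.im + 1) *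
    (((n + 1 : ℕ) : ℝ) ^ j * Real.exp (-(p.2.im / 2)) ^ (n + 1))
  have hv : Summable v := by
    refine Summable.mul_left _ ?_
    refine (summable_nat_add_iff (f := fun n : ℕ => (n : ℝ) ^ j *
      Real.exp (-(p.2.im / 2)) ^ n) 1).mpr ?_
    refine summable_pow_mul_geometric_of_norm_lt_one j ?_
    rw [Real.norm_of_nonneg (Real.exp_pos _).le, Real.exp_lt_one_iff]
    linarith [hp.1]
  let t : ℕ → ℝ := fun n => if n < N then
    ‖((n : ℂ) + 1) ^ j * h (((n : ℂ) + 1) * p.2 - p.1)‖ + 1 else 0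
  have ht : Summable t := summable_of_ne_finset_zero (s := Finset.range N) fun n hn => by
    simp only [Finset.mem_range] at hn
    simp [t, hn]
  have hv0 : ∀ n, 0 ≤ v n := fun n => by positivity
  have ht0 : ∀ n, 0 ≤ t n := fun n => by simp only [t]; split_ifs <;> positivity
  refine ⟨fun n => v n + t n, hv.add ht, ?_⟩
  have hfin : ∀ᶠ x : ℂ × ℂ in 𝓝 p, ∀ n ∈ Finset.range N,
      ‖((n : ℂ) + 1) ^ j * h (((n : ℂ) + 1) * x.2 - x.1)‖ <
        ‖((n : ℂ) + 1) ^ j * h (((n : ℂ) + 1) * p.2 - p.1)‖ + 1 := by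
    rw [Filter.eventually_all_finset]
    intro n _
    exact (H.analyticAt_term j n hp).continuousAt.norm.eventually
      (gt_mem_nhds (lt_add_one _))
  filter_upwards [hN, hfin, (isOpen_latDomain H.isOpen H.upper).mem_nhds hp] with x hx hx' hxD
  refine ⟨hxD, fun n => ?_⟩
  by_cases hn : n < N
  · have := hx' n (Finset.mem_range.mpr hn)
    simp only [t, hn, if_true]
    linarith [hv0 n]
  · refine le_trans ?_ (le_add_of_nonneg_right (ht0 n))
    have h1 := hC _ (hx.2.2 n (not_lt.mp hn))
    rw [im_mul_sub] at h1
    have h2 : Real.exp (-(((n : ℝ) + 1) * x.2.im - x.1.im)) ≤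
        Real.exp (p.1.im + 1) * Real.exp (-(p.2.im / 2)) ^ (n + 1) := by
      rw [← Real.exp_nat_mul, ← Real.exp_add]
      refine Real.exp_le_exp.mpr ?_
      push_cast
      have : (0 : ℝ) < n + 1 := by positivity
      nlinarith [hx.1, hx.2.1]
    have h3 : ‖((n : ℂ) + 1) ^ j‖ = ((n + 1 : ℕ) : ℝ) ^ j := by
      rw [norm_pow]
      congr 1
      exact_mod_cast Complex.norm_natCast (n + 1)
    rw [norm_mul, h3]
    calc _ ≤ ((n + 1 : ℕ) : ℝ) ^ j * (C * (Real.exp (p.1.im + 1) *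
          Real.exp (-(p.2.im / 2)) ^ (n + 1))) := by
            gcongr
            exact h1.trans (by gcongr)
      _ = v n := by simp only [v]; ring

lemma UpperDecay.summable_norm (H : UpperDecay h D) (j : ℕ) {z τ : ℂ}
    (hp : (z, τ) ∈ latDomain D) :
    Summable fun n : ℕ => ‖((n : ℂ) + 1) ^ j * h (((n : ℂ) + 1) * τ - z)‖ := by
  obtain ⟨u, hu, hb⟩ := H.eventually_norm_term_le j hp
  exact Summable.of_nonneg_of_le (fun _ => norm_nonneg _) hb.self_of_nhds.2 hu

lemma UpperDecay.analyticAt_latSeries (H : UpperDecay h D) (j : ℕ) {p : ℂ × ℂ}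
    (hp : p ∈ latDomain D) : AnalyticAt ℂ (fun x : ℂ × ℂ => latSeries h j x.1 x.2) p := by
  obtain ⟨u, hu, hb⟩ := H.eventually_norm_term_le j hp
  exact analyticAt_tsum_of_summable_norm hu (hb.mono fun x hx n =>
    ⟨H.analyticAt_term j n hx.1, hx.2 n⟩)

/-- Handles both partial derivatives at once: $n\tau-z$ has constant derivative $-1$ along $z$ and
$n$ along $\tau$, which is why $\partial_\tau$ raises the exponent `j`. -/
lemma UpperDecay.hasDerivAt_latSeries_comp (H : UpperDecay h D)
    (hd : ∀ w ∈ D, HasDerivAt h (h' w) w) (j : ℕ) {p : ℂ × ℂ} (hp : p ∈ latDomain D)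
    {γ : ℂ → ℂ × ℂ} {s : ℂ} (hγ : Continuous γ) (hs : γ s = p) {e : ℕ → ℂ}
    (hγ' : ∀ (n : ℕ) (s : ℂ), HasDerivAt (fun s => ((n : ℂ) + 1) * (γ s).2 - (γ s).1) (e n) s) :
    HasDerivAt (fun s => latSeries h j (γ s).1 (γ s).2)
      (∑' n : ℕ, ((n : ℂ) + 1) ^ j * (h' (((n : ℂ) + 1) * p.2 - p.1) * e n)) s := by
  subst hs
  obtain ⟨u, hu, hb⟩ := H.eventually_norm_term_le j hp
  have hb' := hγ.continuousAt.eventually hb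
  obtain ⟨R, hR, hb⟩ := Metric.nhds_basis_ball.eventually_iff.mp hb'
  have hder : ∀ (n : ℕ), ∀ s' ∈ ball s R, HasDerivAt
      (fun s => ((n : ℂ) + 1) ^ j * h (((n : ℂ) + 1) * (γ s).2 - (γ s).1))
      (((n : ℂ) + 1) ^ j * (h' (((n : ℂ) + 1) * (γ s').2 - (γ s').1) * e n)) s' :=
    fun n s' hs' => ((hd _ ((hb hs').1.2 n)).comp s' (hγ' n s')).const_mul _
  have h1 := Complex.hasSum_deriv_of_summable_norm hu
    (fun n s' hs' => (hder n s' hs').differentiableAt.differentiableWithinAt) isOpen_ball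
    (fun n s' hs' => (hb hs').2 n) (mem_ball_self hR)
  have h2 := (Complex.differentiableOn_tsum_of_summable_norm hu
    (fun n s' hs' => (hder n s' hs').differentiableAt.differentiableWithinAt) isOpen_ball
    (fun n s' hs' => (hb hs').2 n)).differentiableAt (isOpen_ball.mem_nhds (mem_ball_self hR))
  have h3 := h2.hasDerivAt
  rw [← h1.tsum_eq, tsum_congr fun n => (hder n s (mem_ball_self hR)).deriv] at h3
  exact h3

lemma UpperDecay.hasDerivAt_latSeries_fst (H : UpperDecay h D)
    (hd : ∀ w ∈ D, HasDerivAt h (h' w) w) (j : ℕ) {z τ : ℂ} (hp : (z, τ) ∈ latDomain D) :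
    HasDerivAt (fun z => latSeries h j z τ) (-latSeries h' j z τ) z := by
  have h1 := H.hasDerivAt_latSeries_comp hd j hp (γ := fun z => (z, τ)) (s := z) (by fun_prop) rfl
    (e := fun _ => -1) fun n s => (hasDerivAt_id' s).const_sub (((n : ℂ) + 1) * τ)
  convert! h1 using 1
  rw [latSeries, ← tsum_neg]
  congr 1; ext n; ring

lemma UpperDecay.hasDerivAt_latSeries_snd (H : UpperDecay h D)
    (hd : ∀ w ∈ D, HasDerivAt h (h' w) w) (j : ℕ) {z τ : ℂ} (hp : (z, τ) ∈ latDomain D) :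
    HasDerivAt (fun τ => latSeries h j z τ) (latSeries h' (j + 1) z τ) τ := by
  have h1 := H.hasDerivAt_latSeries_comp hd j hp (γ := fun τ => (z, τ)) (s := τ) (by fun_prop) rfl
    (e := fun n => (n : ℂ) + 1) fun n s => by
      simpa using ((hasDerivAt_id s).const_mul ((n : ℂ) + 1)).sub_const z
  convert! h1 using 1
  rw [latSeries]
  congr 1; ext n; ring

lemma latSeries_const_mul (c : ℂ) (h : ℂ → ℂ) (j : ℕ) (z τ : ℂ) :
    latSeries (fun w => c * h w) j z τ = c * latSeries h j z τ := by
  rw [latSeries, latSeries, ← tsum_mul_left]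
  congr 1; ext n; ring

end LatticeSeries

/-! ### Polylogarithms of exponentials -/

section ExpPolylog

open Metric Set Filter Topology

/-- The upper half plane as a subset of `ℂ`. -/
def upper : Set ℂ := {w | 0 < w.im}

/-- The function `w ↦ Li_r(e ^ (2πiw))`. -/
def expPolylog (r : ℕ) (w : ℂ) : ℂ := polylog r (Complex.exp (2 * Real.pi * Complex.I * w))

/-- The function `w ↦ e ^ (2πiw) / (1 - e ^ (2πiw))`, which continues `Li_0(e ^ (2πiw))`. -/
def expGeom (w : ℂ) : ℂ :=
  Complex.exp (2 * Real.pi * Complex.I * w) / (1 - Complex.exp (2 * Real.pi * Complex.I * w))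

/-- The complement of the integers. -/
def nonInt : Set ℂ := {w | ∀ n : ℤ, w ≠ n}

lemma isOpen_upper : IsOpen upper := isOpen_lt continuous_const Complex.continuous_im

lemma convex_upper : Convex ℝ upper := convex_halfSpace_im_gt 0

lemma norm_exp_two_pi_I (w : ℂ) :
    ‖Complex.exp (2 * Real.pi * Complex.I * w)‖ = Real.exp (-(2 * Real.pi * w.im)) := by
  rw [Complex.norm_exp]
  congr 1
  simp

lemma norm_exp_two_pi_I_lt_one {w : ℂ} (hw : 0 < w.im) :
    ‖Complex.exp (2 * Real.pi * Complex.I * w)‖ < 1 := by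
  rw [norm_exp_two_pi_I, Real.exp_lt_one_iff]
  have := Real.pi_pos
  nlinarith [mul_pos this hw]

lemma exp_two_pi_I_eq_one_iff (w : ℂ) :
    Complex.exp (2 * Real.pi * Complex.I * w) = 1 ↔ ∃ n : ℤ, w = n := by
  rw [Complex.exp_eq_one_iff]
  refine exists_congr fun n => ?_
  rw [mul_comm (n : ℂ)]
  exact mul_right_inj' Complex.two_pi_I_ne_zero

lemma one_sub_exp_ne_zero {w : ℂ} (hw : w ∈ nonInt) :
    1 - Complex.exp (2 * Real.pi * Complex.I * w) ≠ 0 := fun h => by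
  obtain ⟨n, hn⟩ := (exp_two_pi_I_eq_one_iff w).mp (sub_eq_zero.mp h).symm
  exact hw n hn

lemma upper_subset_nonInt : upper ⊆ nonInt := by
  rintro w hw n rfl
  simp [upper] at hw

lemma isOpen_nonInt : IsOpen nonInt := by
  have : nonInt = {w | Complex.exp (2 * Real.pi * Complex.I * w) ≠ 1} := by
    ext w
    simp [nonInt, exp_two_pi_I_eq_one_iff]
  rw [this]
  exact isOpen_ne_fun (by fun_prop) continuous_const

lemma norm_polylog_term_le (r n : ℕ) (w : ℂ) :
    ‖w ^ (n + 1) / ((n : ℂ) + 1) ^ r‖ ≤ ‖w‖ ^ (n + 1) := by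
  rw [norm_div, norm_pow, norm_pow]
  refine div_le_self (by positivity) (one_le_pow₀ ?_)
  have : ‖(n : ℂ) + 1‖ = n + 1 := by exact_mod_cast Complex.norm_natCast (n + 1)
  rw [this]
  linarith [(Nat.cast_nonneg n : (0 : ℝ) ≤ n)]

lemma norm_polylog_le (r : ℕ) {w : ℂ} (hw : ‖w‖ < 1) : ‖polylog r w‖ ≤ ‖w‖ / (1 - ‖w‖) := by
  have h : HasSum (fun n : ℕ => ‖w‖ ^ (n + 1)) (‖w‖ / (1 - ‖w‖)) := by
    simpa [pow_succ, div_eq_inv_mul] using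
      (hasSum_geometric_of_lt_one (norm_nonneg w) hw).mul_right ‖w‖
  exact tsum_of_norm_bounded h fun n => norm_polylog_term_le r n w

lemma expPolylog_zero {w : ℂ} (hw : w ∈ upper) : expPolylog 0 w = expGeom w := by
  have h := (hasSum_geometric_of_norm_lt_one (norm_exp_two_pi_I_lt_one hw)).mul_right
    (Complex.exp (2 * Real.pi * Complex.I * w))
  rw [expPolylog, polylog, expGeom, div_eq_inv_mul, ← h.tsum_eq]
  simp [pow_succ]

lemma exp_decay {w : ℂ} (hw : 1 ≤ w.im) :
    ‖Complex.exp (2 * Real.pi * Complex.I * w)‖ ≤ 1 / 2 ∧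
      ‖Complex.exp (2 * Real.pi * Complex.I * w)‖ ≤ Real.exp (-w.im) := by
  have hpi := Real.pi_gt_three
  rw [norm_exp_two_pi_I]
  have h1 : Real.exp (-(2 * Real.pi * w.im)) ≤ Real.exp (-w.im) := by
    apply Real.exp_le_exp.mpr
    nlinarith
  refine ⟨?_, h1⟩
  refine h1.trans ?_
  rw [Real.exp_neg, one_div]
  apply inv_anti₀ two_pos
  linarith [Real.add_one_le_exp w.im]

lemma hasDerivAt_expPolylog (r : ℕ) {w : ℂ} (hw : w ∈ upper) :
    HasDerivAt (expPolylog (r + 1)) (2 * Real.pi * Complex.I * expPolylog r w) w := by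
  have hw' : 0 < w.im := hw
  -- On this smaller half plane the terms have a geometric majorant, which justifies termwise
  -- differentiation.
  let U : Set ℂ := {v | w.im / 2 < v.im}
  have hU : IsOpen U := isOpen_lt continuous_const Complex.continuous_im
  have hwU : w ∈ U := by simp only [U, mem_ofPred_eq]; linarith
  let ρ : ℝ := Real.exp (-(2 * Real.pi * (w.im / 2)))
  have hρ : Summable fun n : ℕ => ρ ^ (n + 1) := by
    refine (summable_nat_add_iff (f := fun n : ℕ => ρ ^ n) 1).mpr ?_
    refine summable_geometric_of_lt_one (Real.exp_pos _).le ?_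
    rw [Real.exp_lt_one_iff]
    have := mul_pos Real.pi_pos hw'
    linarith
  have hb : ∀ (n : ℕ), ∀ v ∈ U, ‖Complex.exp (2 * Real.pi * Complex.I * v) ^ (n + 1) /
      ((n : ℂ) + 1) ^ (r + 1)‖ ≤ ρ ^ (n + 1) := by
    intro n v hv
    refine (norm_polylog_term_le _ _ _).trans ?_
    rw [norm_exp_two_pi_I]
    refine pow_le_pow_left₀ (Real.exp_pos _).le (Real.exp_le_exp.mpr ?_) _
    have : w.im / 2 < v.im := hv
    nlinarith [Real.pi_pos]
  have hder : ∀ (n : ℕ) (v : ℂ), HasDerivAt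
      (fun v => Complex.exp (2 * Real.pi * Complex.I * v) ^ (n + 1) / ((n : ℂ) + 1) ^ (r + 1))
      (2 * Real.pi * Complex.I * (Complex.exp (2 * Real.pi * Complex.I * v) ^ (n + 1) /
        ((n : ℂ) + 1) ^ r)) v := by
    intro n v
    have h1 := ((((hasDerivAt_id' v).const_mul (2 * Real.pi * Complex.I)).cexp).fun_pow
      (n + 1)).div_const (((n : ℂ) + 1) ^ (r + 1))
    convert! h1 using 1
    have : (n : ℂ) + 1 ≠ 0 := by exact_mod_cast n.succ_ne_zero
    push_cast
    field_simp
    simp [pow_succ]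
    ring
  have hd : ∀ (n : ℕ), DifferentiableOn ℂ (fun v =>
      Complex.exp (2 * Real.pi * Complex.I * v) ^ (n + 1) / ((n : ℂ) + 1) ^ (r + 1)) U :=
    fun n v _ => (hder n v).differentiableAt.differentiableWithinAt
  have h1 := Complex.hasSum_deriv_of_summable_norm hρ hd hU hb hwU
  have h2 := ((Complex.differentiableOn_tsum_of_summable_norm hρ hd hU hb).differentiableAt
    (hU.mem_nhds hwU)).hasDerivAt
  rw [← h1.tsum_eq, tsum_congr fun n => (hder n w).deriv, tsum_mul_left] at h2
  exact h2

lemma norm_expPolylog_le (r : ℕ) {w : ℂ} (hw : 1 ≤ w.im) :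
    ‖expPolylog r w‖ ≤ 2 * Real.exp (-w.im) := by
  obtain ⟨h1, h2⟩ := exp_decay hw
  refine (norm_polylog_le r (by linarith)).trans ?_
  rw [div_le_iff₀ (by linarith)]
  nlinarith [Real.exp_pos (-w.im)]

lemma upperDecay_expPolylog (r : ℕ) : UpperDecay (expPolylog (r + 1)) upper where
  isOpen := isOpen_upper
  upper _ hw := hw
  diff _ hw := (hasDerivAt_expPolylog r hw).differentiableAt.differentiableWithinAt
  decay := ⟨2, fun _ hw => norm_expPolylog_le (r + 1) hw⟩

lemma upperDecay_expGeom : UpperDecay expGeom nonInt where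
  isOpen := isOpen_nonInt
  upper _ hw := upper_subset_nonInt hw
  diff := by
    intro w hw
    have h := one_sub_exp_ne_zero hw
    have h1 : DifferentiableAt ℂ (fun w : ℂ => Complex.exp (2 * Real.pi * Complex.I * w)) w := by
      fun_prop
    exact (h1.div (h1.const_sub 1) h).differentiableWithinAt
  decay := ⟨2, fun w hw => by
    rw [← expPolylog_zero (by simp only [EllipticTrilog.upper, mem_ofPred_eq]; linarith)]
    exact norm_expPolylog_le 0 hw⟩

lemma hasDerivAt_expPolylog_one {w : ℂ} (hw : w ∈ upper) :
    HasDerivAt (expPolylog 1) (2 * Real.pi * Complex.I * expGeom w) w := by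
  rw [← expPolylog_zero hw]
  exact hasDerivAt_expPolylog 0 hw

end ExpPolylog

/-! ### Continuation of the trilogarithm -/

section Continuation

open Metric Set Filter Topology

/-- The plane cut along the rays `m - t(s + i)`, `t ≥ 0`, `m ∈ ℤ`. -/
def cutPlane (s : ℝ) : Set ℂ := {w | 0 < w.im ∨ ∀ m : ℤ, w.re - s * w.im ≠ m}

/-- The open strip between two consecutive lines of direction `s + i` through integers. -/
def slantStrip (s : ℝ) (m : ℤ) : Set ℂ := {w | (m : ℝ) < w.re - s * w.im ∧ w.re - s * w.im < m + 1}

lemma continuous_slant (s : ℝ) : Continuous fun w : ℂ => w.re - s * w.im := by fun_prop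

lemma isOpen_slantStrip (s : ℝ) (m : ℤ) : IsOpen (slantStrip s m) :=
  (isOpen_lt continuous_const (continuous_slant s)).inter
    (isOpen_lt (continuous_slant s) continuous_const)

lemma convex_slantStrip (s : ℝ) (m : ℤ) : Convex ℝ (slantStrip s m) := by
  have h : IsLinearMap ℝ fun w : ℂ => w.re - s * w.im :=
    ⟨fun a b => by simp; ring, fun c a => by simp; ring⟩
  exact (convex_halfSpace_gt h _).inter (convex_halfSpace_lt h _)

lemma slantStrip_subset_nonInt (s : ℝ) (m : ℤ) : slantStrip s m ⊆ nonInt := by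
  rintro w ⟨h1, h2⟩ n rfl
  simp only [Complex.intCast_re, Complex.intCast_im, mul_zero, sub_zero] at h1 h2
  norm_cast at h1 h2
  omega

/-- Each strip is convex and meets the upper half plane in a convex set, and distinct strips are
disjoint. Primitives can thus be continued strip by strip without monodromy. -/
lemma cutPlane_eq (s : ℝ) : cutPlane s = upper ∪ ⋃ m, slantStrip s m := by
  ext w
  simp only [cutPlane, upper, slantStrip, mem_union, mem_ofPred_eq, mem_iUnion]
  refine or_congr_right ⟨fun h => ?_, ?_⟩
  · refine ⟨⌊w.re - s * w.im⌋, lt_of_le_of_ne (Int.floor_le _) (h _).symm, Int.lt_floor_add_one _⟩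
  · rintro ⟨m, h1, h2⟩ n hn
    rw [hn] at h1 h2
    norm_cast at h1 h2
    omega

lemma isOpen_cutPlane (s : ℝ) : IsOpen (cutPlane s) := by
  rw [cutPlane_eq]
  exact isOpen_upper.union (isOpen_iUnion fun m => isOpen_slantStrip s m)

lemma cutPlane_subset_nonInt (s : ℝ) : cutPlane s ⊆ nonInt := by
  rw [cutPlane_eq]
  exact union_subset upper_subset_nonInt (iUnion_subset fun m => slantStrip_subset_nonInt s m)

/-- The cuts are traversed downwards in direction $-(s+i)$, so moving in direction $s+i$ never
enters one. This supplies the paths that prove connectedness. -/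
lemma add_mem_cutPlane {s : ℝ} {w : ℂ} (hw : w ∈ cutPlane s) {t : ℝ} (ht : 0 ≤ t) :
    w + t * (s + Complex.I) ∈ cutPlane s := by
  rcases hw with hw | hw
  · left; simp; linarith
  · right
    intro m hm
    apply hw m
    rw [← hm]
    simp; ring

/-- A function on the upper half plane whose derivative extends holomorphically to a convex open set
extends to that set along with its derivative. -/
lemma exists_primitive_extension {V : Set ℂ} (hV : IsOpen V) (hVc : Convex ℝ V)
    (hne : (V ∩ upper).Nonempty) {f L : ℂ → ℂ} (hf : DifferentiableOn ℂ f V)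
    (hL : ∀ w ∈ V ∩ upper, HasDerivAt L (f w) w) :
    ∃ G : ℂ → ℂ, (∀ w ∈ V, HasDerivAt G (f w) w) ∧ ∀ w ∈ V ∩ upper, G w = L w := by
  obtain ⟨G, hG⟩ := hVc.exists_forall_hasDerivWithinAt hf
  have hG' : ∀ w ∈ V, HasDerivAt G (f w) w := fun w hw => (hG w hw).hasDerivAt (hV.mem_nhds hw)
  obtain ⟨w₀, hw₀⟩ := hne
  refine ⟨fun w => G w - (G w₀ - L w₀), fun w hw => (hG' w hw).sub_const _, fun w hw => ?_⟩
  have hd : ∀ v ∈ V ∩ upper, HasDerivAt (fun v => G v - L v) 0 v := fun v hv => by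
    simpa using (hG' v hv.1).fun_sub (hL v hv)
  have := (hV.inter isOpen_upper).is_const_of_deriv_eq_zero
    (hVc.inter convex_upper).isPreconnected
    (fun v hv => (hd v hv).differentiableAt.differentiableWithinAt) (fun v hv => (hd v hv).deriv)
    hw hw₀
  linear_combination this

/-- $\mathrm{Li}_0$ becomes `expGeom`, holomorphic off the integers; each further polylogarithm is a
primitive of the previous one, and a convex strip has primitives. -/
lemma exists_expPolylog_extension (s : ℝ) (m : ℤ) (r : ℕ) :
    ∃ G : ℂ → ℂ, DifferentiableOn ℂ G (slantStrip s m) ∧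
      ∀ w ∈ slantStrip s m ∩ upper, G w = expPolylog r w := by
  have hne : (slantStrip s m ∩ upper).Nonempty := by
    -- The point at height $1$ on the central line of the strip.
    refine ⟨((m + 1 / 2 : ℝ) : ℂ) + ((1 : ℝ) : ℂ) * (s + Complex.I), ⟨?_, ?_⟩, ?_⟩
    · simp
    · simp; norm_num
    · simp [upper]
  induction r with
  | zero =>
    exact ⟨expGeom, upperDecay_expGeom.diff.mono (slantStrip_subset_nonInt s m),
      fun w hw => (expPolylog_zero hw.2).symm⟩
  | succ r ih =>
    obtain ⟨f, hf, hfe⟩ := ih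
    obtain ⟨G, hG, hGe⟩ := exists_primitive_extension (isOpen_slantStrip s m)
      (convex_slantStrip s m) hne (hf.const_mul (2 * Real.pi * Complex.I))
      (L := expPolylog (r + 1)) fun w hw => by
        simp only [hfe w hw]
        exact hasDerivAt_expPolylog r hw.2
    exact ⟨G, fun w hw => (hG w hw).differentiableAt.differentiableWithinAt, hGe⟩

lemma exists_expPolylog_continuation (s : ℝ) (r : ℕ) :
    ∃ g : ℂ → ℂ, UpperDecay g (cutPlane s) ∧ ∀ w ∈ upper, g w = expPolylog (r + 1) w := by
  choose G hG hGe using fun m => exists_expPolylog_extension s m (r + 1)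
  classical
  let g : ℂ → ℂ := fun w => if 0 < w.im then expPolylog (r + 1) w else G ⌊w.re - s * w.im⌋ w
  have hgu : ∀ w ∈ upper, g w = expPolylog (r + 1) w := fun w hw => if_pos hw
  have hgs : ∀ m, ∀ w ∈ slantStrip s m, g w = G m w := by
    intro m w hw
    by_cases h : 0 < w.im
    · rw [hgu w h, hGe m w ⟨hw, h⟩]
    · have : ⌊w.re - s * w.im⌋ = m := Int.floor_eq_iff.mpr ⟨hw.1.le, hw.2⟩
      simp only [g, h, if_false, this]
  refine ⟨g, ⟨isOpen_cutPlane s, fun w hw => Or.inl hw, ?_, 2, fun w hw => ?_⟩, hgu⟩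
  · intro w hw
    rw [cutPlane_eq] at hw
    refine DifferentiableAt.differentiableWithinAt ?_
    rcases hw with hw | hw
    · exact (hasDerivAt_expPolylog r hw).differentiableAt.congr_of_eventuallyEq
        (eventually_of_mem (isOpen_upper.mem_nhds hw) hgu)
    · obtain ⟨m, hm⟩ := mem_iUnion.mp hw
      exact ((hG m).differentiableAt ((isOpen_slantStrip s m).mem_nhds hm)).congr_of_eventuallyEq
        (eventually_of_mem ((isOpen_slantStrip s m).mem_nhds hm) (hgs m))
  · rw [hgu w (by simp only [upper, mem_ofPred_eq]; linarith)]
    exact norm_expPolylog_le _ hw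

end Continuation

/-! ### Existence of branches -/

section Branch

open Metric Set Filter Topology

/-- The series of `f`, with `g` in place of `w ↦ Li_3(e ^ (2πiw))` in the terms involving `z`. -/
def branchFun (g : ℂ → ℂ) (z τ : ℂ) : ℂ :=
  1 / (2 * Real.pi * Complex.I) ^ 3 *
    ((g z + latSeries g 0 (-z) τ + latSeries g 0 z τ
        - chi 3 (2 * Real.pi * Complex.I * z) (2 * Real.pi * Complex.I * τ))
      - (polylog 3 1 + 2 * latSeries (expPolylog 3) 0 0 τ
        - chi 3 (2 * Real.pi * Complex.I * 0) (2 * Real.pi * Complex.I * τ)))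

lemma mem_latDomain_upper {z τ : ℂ} (hτ : 0 < τ.im) (hz : z.im < τ.im) :
    (z, τ) ∈ latDomain upper := by
  refine ⟨hτ, fun n => ?_⟩
  change (0 : ℝ) < (_ : ℂ).im
  rw [im_mul_sub]
  have : (0 : ℝ) ≤ n := Nat.cast_nonneg n
  simp only
  nlinarith

lemma latDomain_mono {D D' : Set ℂ} (h : D ⊆ D') : latDomain D ⊆ latDomain D' :=
  fun _ hp => ⟨hp.1, fun n => h (hp.2 n)⟩

lemma tsum_polylog_exp (r : ℕ) (z τ : ℂ) :
    ∑' n : ℕ, polylog r (Complex.exp (2 * Real.pi * Complex.I * τ) ^ (n + 1) *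
      Complex.exp (2 * Real.pi * Complex.I * z)) = latSeries (expPolylog r) 0 (-z) τ := by
  refine tsum_congr fun n => ?_
  rw [pow_zero, one_mul, expPolylog, ← Complex.exp_nat_mul, ← Complex.exp_add]
  congr 2
  push_cast
  ring

/-- Only the points $n\tau+z$ with $n\ge1$ are constrained, so this also covers $z=0$, where the
separated first term is $\mathrm{Li}_r$ at $1$. -/
lemma ellipticPolylog_eq (r : ℕ) {z τ : ℂ} (hz : (-z, τ) ∈ latDomain upper) :
    ellipticPolylog (r + 1) z τ = expPolylog (r + 1) z + latSeries (expPolylog (r + 1)) 0 (-z) τ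
      + latSeries (expPolylog (r + 1)) 0 z τ
      - chi (r + 1) (2 * Real.pi * Complex.I * z) (2 * Real.pi * Complex.I * τ) := by
  have hs : Summable fun n : ℕ => polylog (r + 1) (Complex.exp (2 * Real.pi * Complex.I * τ) ^ n *
      Complex.exp (2 * Real.pi * Complex.I * z)) := by
    rw [← summable_nat_add_iff 1]
    refine ((upperDecay_expPolylog r).summable_norm 0 hz).of_norm.congr fun n => ?_
    rw [pow_zero, one_mul, expPolylog, ← Complex.exp_nat_mul, ← Complex.exp_add]
    congr 2
    push_cast
    ring
  have h1 := tsum_polylog_exp (r + 1) (-z) τ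
  rw [neg_neg, mul_neg, Complex.exp_neg] at h1
  simp only [ellipticPolylog]
  rw [hs.tsum_eq_zero_add, tsum_polylog_exp, h1, pow_zero, one_mul, expPolylog]

lemma fSeries_eq {z τ : ℂ} (h : (z, τ) ∈ strip) : fSeries z τ = branchFun (expPolylog 3) z τ := by
  have h1 : 0 < z.im := h.1
  have h2 : z.im < τ.im := h.2
  have hτ : 0 < τ.im := h1.trans h2
  rw [fSeries, branchFun, ellipticPolylog_eq 2 (mem_latDomain_upper hτ (by simp; linarith)),
    ellipticPolylog_eq 2 (mem_latDomain_upper hτ (by simpa using hτ))]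
  have h0 : expPolylog 3 0 = polylog 3 1 := by simp [expPolylog]
  simp only [neg_zero, h0, Nat.reduceAdd]
  ring

lemma latSeries_congr {g h : ℂ → ℂ} {D : Set ℂ} (hgh : ∀ w ∈ D, g w = h w) (j : ℕ) {z τ : ℂ}
    (hp : (z, τ) ∈ latDomain D) : latSeries g j z τ = latSeries h j z τ :=
  tsum_congr fun n => by rw [hgh _ (hp.2 n)]

lemma branchFun_congr {g : ℂ → ℂ} (hg : ∀ w ∈ upper, g w = expPolylog 3 w) {z τ : ℂ}
    (h : (z, τ) ∈ strip) : branchFun g z τ = branchFun (expPolylog 3) z τ := by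
  have h1 : 0 < z.im := h.1
  have h2 : z.im < τ.im := h.2
  have hτ : 0 < τ.im := h1.trans h2
  rw [branchFun, branchFun, hg z h1, latSeries_congr hg 0 (mem_latDomain_upper hτ h2),
    latSeries_congr hg 0 (mem_latDomain_upper (z := -z) hτ (by simp; linarith))]

/-- The pairs `(z, τ)` with `Im τ > 0` such that `z`, `nτ + z` and `nτ - z`, `n ≥ 1`, lie in `D`. -/
def pairDomain (D : Set ℂ) : Set (ℂ × ℂ) :=
  {p | p.1 ∈ D ∧ p ∈ latDomain D ∧ (-p.1, p.2) ∈ latDomain D}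

lemma isOpen_pairDomain {D : Set ℂ} (hD : IsOpen D) (hup : ∀ w : ℂ, 0 < w.im → w ∈ D) :
    IsOpen (pairDomain D) := by
  have h := isOpen_latDomain hD hup
  exact (hD.preimage continuous_fst).inter (h.inter (h.preimage
    (by fun_prop : Continuous fun p : ℂ × ℂ => (-p.1, p.2))))

lemma strip_subset_pairDomain {D : Set ℂ} (hup : ∀ w : ℂ, 0 < w.im → w ∈ D) :
    strip ⊆ pairDomain D := by
  rintro ⟨z, τ⟩ ⟨h1, h2⟩
  simp only at h1 h2
  have hτ : 0 < τ.im := h1.trans h2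
  exact ⟨hup z h1, latDomain_mono hup (mem_latDomain_upper hτ h2),
    latDomain_mono hup (mem_latDomain_upper hτ (by simp; linarith))⟩

/-- The sign of the coefficient of $\tau$ decides which of $z$, $n\tau-z$, $n\tau+z$ would be an
integer. -/
lemma pairDomain_nonInt : pairDomain nonInt = regularSet := by
  ext ⟨z, τ⟩
  constructor
  · rintro ⟨h1, h2, h3⟩
    refine ⟨h2.1, ?_⟩
    rintro ⟨m, k, hmk⟩
    simp only at hmk h1
    rcases lt_trichotomy k 0 with hk | hk | hk
    · obtain ⟨n, rfl⟩ : ∃ n : ℕ, k = -(n + 1) := ⟨(-k - 1).toNat, by omega⟩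
      apply h3.2 n m
      simp only
      rw [hmk]; push_cast; ring
    · subst hk
      exact h1 m (by simpa using hmk)
    · obtain ⟨n, rfl⟩ : ∃ n : ℕ, k = n + 1 := ⟨(k - 1).toNat, by omega⟩
      apply h2.2 n (-m)
      simp only
      rw [hmk]; push_cast; ring
  · rintro ⟨hτ, hz⟩
    refine ⟨fun n hn => hz ⟨n, 0, ?_⟩, ⟨hτ, fun n m hm => hz ⟨-m, n + 1, ?_⟩⟩,
      ⟨hτ, fun n m hm => hz ⟨m, -(n + 1), ?_⟩⟩⟩
    · simpa using hn
    · simp only at hm ⊢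
      push_cast; linear_combination -hm
    · simp only at hm ⊢
      push_cast; linear_combination hm

lemma pairDomain_mono {D D' : Set ℂ} (h : D ⊆ D') : pairDomain D ⊆ pairDomain D' :=
  fun _ hp => ⟨h hp.1, latDomain_mono h hp.2.1, latDomain_mono h hp.2.2⟩

lemma convex_strip : Convex ℝ strip := by
  rintro p ⟨hp1, hp2⟩ q ⟨hq1, hq2⟩ a b ha hb hab
  constructor
  · simp only [Prod.fst_add, Prod.smul_fst, Complex.add_im, Complex.smul_im, smul_eq_mul]
    rcases ha.eq_or_lt with rfl | ha
    · have : b = 1 := by linarith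
      subst this; linarith
    · nlinarith [mul_pos ha hp1, mul_nonneg hb hq1.le]
  · simp only [Prod.fst_add, Prod.smul_fst, Complex.add_im, Complex.smul_im, smul_eq_mul,
      Prod.snd_add, Prod.smul_snd]
    rcases ha.eq_or_lt with rfl | ha
    · have : b = 1 := by linarith
      subst this; linarith
    · nlinarith [mul_lt_mul_of_pos_left hp2 ha, mul_le_mul_of_nonneg_left hq2.le hb]

lemma strip_nonempty : strip.Nonempty :=
  ⟨(Complex.I, 2 * Complex.I), by simp [strip]⟩

/-- Every point is joined to the convex set `strip` by moving first $\tau$, then $z$, in direction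
$s+i$. Raising $\tau$ first keeps the points $n\tau-z$ in the upper half plane while $z$ moves. -/
lemma isConnected_pairDomain_cutPlane (s : ℝ) : IsConnected (pairDomain (cutPlane s)) := by
  have hsub : strip ⊆ pairDomain (cutPlane s) := strip_subset_pairDomain fun _ => Or.inl
  obtain ⟨p₀, hp₀⟩ := strip_nonempty
  refine ⟨⟨p₀, hsub hp₀⟩, isPreconnected_of_forall p₀ ?_⟩
  rintro ⟨z, τ⟩ ⟨hz, h1, h2⟩
  simp only at hz
  have hτ : 0 < τ.im := h1.1
  let v : ℂ := s + Complex.I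
  have hv : ∀ t : ℝ, ((t : ℂ) * v).im = t := fun t => by simp [v]
  -- `R` lifts $z$ above the real axis; `T` lifts $\tau$ above every height that $z$ then reaches.
  let R : ℝ := |z.im| + 1
  let T : ℝ := z.im + R + |z.im| + 1
  have hR : 0 < z.im + R := by simp only [R]; linarith [neg_abs_le z.im]
  have hR0 : 0 ≤ R := by positivity
  have hT0 : 0 ≤ T := by simp only [T]; positivity
  let γ₁ : ℝ → ℂ × ℂ := fun t => (z, τ + t * v)
  let γ₂ : ℝ → ℂ × ℂ := fun t => (z + t * v, τ + T * v)
  have hγ₁ : IsPreconnected (γ₁ '' Icc 0 T) :=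
    isPreconnected_Icc.image _ (by fun_prop)
  have hγ₂ : IsPreconnected (γ₂ '' Icc 0 R) :=
    isPreconnected_Icc.image _ (by fun_prop)
  have hs₁ : γ₁ '' Icc 0 T ⊆ pairDomain (cutPlane s) := by
    rintro _ ⟨t, ht, rfl⟩
    have hτt : 0 < (τ + t * v).im := by rw [Complex.add_im, hv]; linarith [ht.1]
    refine ⟨hz, ⟨hτt, fun n => ?_⟩, ⟨hτt, fun n => ?_⟩⟩
    · have := add_mem_cutPlane (h1.2 n) (t := ((n : ℝ) + 1) * t)
        (mul_nonneg (by positivity) ht.1)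
      convert this using 1
      simp only [γ₁, v]; push_cast; ring
    · have := add_mem_cutPlane (h2.2 n) (t := ((n : ℝ) + 1) * t)
        (mul_nonneg (by positivity) ht.1)
      convert this using 1
      simp only [γ₁, v]; push_cast; ring
  have hs₂ : γ₂ '' Icc 0 R ⊆ pairDomain (cutPlane s) := by
    rintro _ ⟨t, ht, rfl⟩
    have hτT : (τ + T * v).im = τ.im + T := by rw [Complex.add_im, hv]
    have hzt : (z + t * v).im = z.im + t := by rw [Complex.add_im, hv]
    have hτt : 0 < (τ + T * v).im := by rw [hτT]; linarith
    refine ⟨add_mem_cutPlane hz ht.1, ?_, ⟨hτt, fun n => ?_⟩⟩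
    · refine latDomain_mono (fun _ => Or.inl) (mem_latDomain_upper hτt ?_)
      rw [hzt, hτT]
      simp only [T]
      linarith [ht.2, abs_nonneg z.im]
    · have := add_mem_cutPlane (h2.2 n) (t := ((n : ℝ) + 1) * T + t)
        (add_nonneg (mul_nonneg (by positivity) hT0) ht.1)
      convert this using 1
      simp only [γ₂, v]; push_cast; ring
  refine ⟨strip ∪ γ₂ '' Icc 0 R ∪ γ₁ '' Icc 0 T, union_subset (union_subset hsub hs₂) hs₁,
    Or.inl (Or.inl hp₀), Or.inr ⟨0, ⟨le_rfl, hT0⟩, by simp [γ₁]⟩, ?_⟩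
  refine IsPreconnected.union (γ₁ T) (Or.inr ⟨0, ⟨le_rfl, hR0⟩, by simp [γ₁, γ₂]⟩)
    ⟨T, ⟨hT0, le_rfl⟩, rfl⟩ ?_ hγ₁
  refine IsPreconnected.union (γ₂ R) ?_ ⟨R, ⟨hR0, le_rfl⟩, rfl⟩ convex_strip.isPreconnected hγ₂
  have hzR : (z + R * v).im = z.im + R := by rw [Complex.add_im, hv]
  have hτT : (τ + T * v).im = τ.im + T := by rw [Complex.add_im, hv]
  refine ⟨?_, ?_⟩
  · simp only [γ₂]; rw [hzR]; exact hR
  · simp only [γ₂]; rw [hzR, hτT]; simp only [T]; linarith [abs_nonneg z.im]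

lemma analyticAt_chi (r : ℕ) (p : ℂ × ℂ) : AnalyticAt ℂ (fun p : ℂ × ℂ =>
    chi r (2 * Real.pi * Complex.I * p.1) (2 * Real.pi * Complex.I * p.2)) p := by
  unfold chi
  exact Finset.analyticAt_fun_sum _ fun j _ =>
    (analyticAt_const.mul ((analyticAt_const.mul analyticAt_fst).pow _)).mul
      ((analyticAt_const.mul analyticAt_snd).pow _)

lemma UpperDecay.analyticAt_latSeries_neg {h : ℂ → ℂ} {D : Set ℂ} (H : UpperDecay h D) (j : ℕ)
    {p : ℂ × ℂ} (hp : (-p.1, p.2) ∈ latDomain D) :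
    AnalyticAt ℂ (fun x : ℂ × ℂ => latSeries h j (-x.1) x.2) p :=
  AnalyticAt.fun_comp (g := fun x : ℂ × ℂ => latSeries h j x.1 x.2)
    (f := fun x : ℂ × ℂ => (-x.1, x.2)) (H.analyticAt_latSeries j hp)
    (analyticAt_fst.neg.prod analyticAt_snd)

lemma UpperDecay.analyticAt_latSeries_zero {h : ℂ → ℂ} {D : Set ℂ} (H : UpperDecay h D) (j : ℕ)
    {p : ℂ × ℂ} (hp : 0 < p.2.im) :
    AnalyticAt ℂ (fun x : ℂ × ℂ => latSeries h j 0 x.2) p :=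
  AnalyticAt.fun_comp (g := fun x : ℂ × ℂ => latSeries h j x.1 x.2)
    (f := fun x : ℂ × ℂ => ((0 : ℂ), x.2)) (H.analyticAt_latSeries j
      (latDomain_mono H.upper (mem_latDomain_upper hp (by simpa using hp))))
    (analyticAt_const.prod analyticAt_snd)

lemma UpperDecay.analyticAt_fst {h : ℂ → ℂ} {D : Set ℂ} (H : UpperDecay h D) {p : ℂ × ℂ}
    (hp : p.1 ∈ D) : AnalyticAt ℂ (fun x : ℂ × ℂ => h x.1) p :=
  AnalyticAt.fun_comp (g := h) (f := Prod.fst) (H.diff.analyticAt (H.isOpen.mem_nhds hp))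
    _root_.analyticAt_fst

lemma isBranch_branchFun {s : ℝ} {g : ℂ → ℂ} (H : UpperDecay g (cutPlane s))
    (hg : ∀ w ∈ upper, g w = expPolylog 3 w) :
    IsBranch (pairDomain (cutPlane s)) (branchFun g) where
  isOpen := isOpen_pairDomain H.isOpen H.upper
  isConnected := isConnected_pairDomain_cutPlane s
  subset_regularSet := by
    rw [← pairDomain_nonInt]
    exact pairDomain_mono (cutPlane_subset_nonInt s)
  strip_subset := strip_subset_pairDomain H.upper
  analytic := by
    rintro p ⟨h1, h2, h3⟩
    have hc : AnalyticAt ℂ (fun p : ℂ × ℂ =>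
        chi 3 (2 * Real.pi * Complex.I * 0) (2 * Real.pi * Complex.I * p.2)) p :=
      AnalyticAt.fun_comp (g := fun p : ℂ × ℂ =>
        chi 3 (2 * Real.pi * Complex.I * p.1) (2 * Real.pi * Complex.I * p.2))
        (f := fun x : ℂ × ℂ => ((0 : ℂ), x.2)) (analyticAt_chi 3 _)
        (analyticAt_const.prod analyticAt_snd)
    exact analyticAt_const.mul (((((H.analyticAt_fst h1).add (H.analyticAt_latSeries_neg 0 h3)).add
      (H.analyticAt_latSeries 0 h2)).sub (analyticAt_chi 3 p)).sub ((analyticAt_const.add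
      (analyticAt_const.mul ((upperDecay_expPolylog 2).analyticAt_latSeries_zero 0 h2.1))).sub hc))
  eq_series := fun p hp => by rw [fSeries_eq hp, branchFun_congr hg hp]

/-- A nonreal $w$ lies on the line of direction $s+i$ through $m$ for a single slope $s$. Countably
many slopes are excluded, so one remains. -/
lemma exists_subset_cutPlane {S : Set ℂ} (hS : S.Countable) (hSn : S ⊆ nonInt) :
    ∃ s : ℝ, S ⊆ cutPlane s := by
  have hB : (⋃ w ∈ S, range fun m : ℤ => (w.re - m) / w.im).Countable :=
    hS.biUnion fun w _ => countable_range _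
  obtain ⟨s, hs⟩ := (hB.dense_compl ℝ).nonempty
  refine ⟨s, fun w hw => or_iff_not_imp_left.mpr fun _ m hm => ?_⟩
  by_cases h0 : w.im = 0
  · refine hSn hw m (Complex.ext ?_ (by simpa using h0))
    simpa [h0] using hm
  · apply hs
    simp only [mem_iUnion, mem_range]
    refine ⟨w, hw, m, ?_⟩
    rw [div_eq_iff h0]
    linarith

theorem exists_isBranch {τ : ℂ} (hτ : 0 < τ.im) {S : Set ℂ} (hS : S.Countable)
    (hSτ : ∀ z ∈ S, z ∉ lattice τ) :
    ∃ (U : Set (ℂ × ℂ)) (F : ℂ → ℂ → ℂ), IsBranch U F ∧ ∀ z ∈ S, (z, τ) ∈ U := by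
  have hreg : ∀ z ∈ S, (z, τ) ∈ pairDomain nonInt := fun z hz => by
    rw [pairDomain_nonInt]; exact ⟨hτ, hSτ z hz⟩
  let S' : Set ℂ := ⋃ z ∈ S, insert z ((range fun n : ℕ => ((n : ℂ) + 1) * τ - z) ∪
    range fun n : ℕ => ((n : ℂ) + 1) * τ - -z)
  have hS' : S'.Countable := hS.biUnion fun z _ =>
    ((countable_range _).union (countable_range _)).insert z
  have hmem : ∀ {D : Set ℂ}, S' ⊆ D ↔ ∀ z ∈ S, (z, τ) ∈ pairDomain D := fun {D} => by
    simp only [S', iUnion_subset_iff, insert_subset_iff, union_subset_iff, range_subset_iff,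
      pairDomain, latDomain, mem_ofPred_eq, hτ, true_and]
  obtain ⟨s, hs⟩ := exists_subset_cutPlane hS' (hmem.mpr hreg)
  obtain ⟨g, H, hg⟩ := exists_expPolylog_continuation s 2
  exact ⟨_, _, isBranch_branchFun H hg, hmem.mp hs⟩

end Branch

/-! ### Third partial derivatives of a branch -/

section PartialDerivatives

open Metric Set Filter Topology

/-- The partial derivative in the first variable. -/
def dFst (Φ : ℂ × ℂ → ℂ) (p : ℂ × ℂ) : ℂ := deriv (fun z => Φ (z, p.2)) p.1

/-- The partial derivative in the second variable. -/
def dSnd (Φ : ℂ × ℂ → ℂ) (p : ℂ × ℂ) : ℂ := deriv (fun τ => Φ (p.1, τ)) p.2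

lemma pd_eq_iterate (F : ℂ → ℂ → ℂ) (n m : ℕ) (z τ : ℂ) :
    pd F n m z τ = dFst^[n] (dSnd^[m] fun p => F p.1 p.2) (z, τ) := by
  have h1 : ∀ (m : ℕ) (z τ : ℂ), iteratedDeriv m (fun τ' => F z τ') τ =
      dSnd^[m] (fun p => F p.1 p.2) (z, τ) := by
    intro m
    induction m with
    | zero => intro z τ; simp
    | succ m ih =>
      intro z τ
      rw [iteratedDeriv_succ, Function.iterate_succ_apply', dSnd]
      congr 1
      ext τ'
      exact ih z τ'
  simp only [pd, h1]
  induction n generalizing z with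
  | zero => simp
  | succ n ih =>
    rw [iteratedDeriv_succ, Function.iterate_succ_apply', dFst]
    congr 1
    ext z'
    exact ih z'

lemma dFst_eqOn {V : Set (ℂ × ℂ)} (hV : IsOpen V) {Φ Ψ Ψ' : ℂ × ℂ → ℂ} (h : EqOn Φ Ψ V)
    (hd : ∀ p ∈ V, HasDerivAt (fun z => Ψ (z, p.2)) (Ψ' p) p.1) : EqOn (dFst Φ) Ψ' V := by
  rintro ⟨z, τ⟩ hp
  have hc : Continuous fun z' : ℂ => (z', τ) := by fun_prop
  have he : (fun z' => Φ (z', τ)) =ᶠ[𝓝 z] fun z' => Ψ (z', τ) :=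
    (hc.continuousAt.eventually (hV.mem_nhds hp)).mono fun z' hz' => h hz'
  exact he.deriv_eq.trans (hd _ hp).deriv

lemma dSnd_eqOn {V : Set (ℂ × ℂ)} (hV : IsOpen V) {Φ Ψ Ψ' : ℂ × ℂ → ℂ} (h : EqOn Φ Ψ V)
    (hd : ∀ p ∈ V, HasDerivAt (fun τ => Ψ (p.1, τ)) (Ψ' p) p.2) : EqOn (dSnd Φ) Ψ' V := by
  rintro ⟨z, τ⟩ hp
  have hc : Continuous fun τ' : ℂ => (z, τ') := by fun_prop
  have he : (fun τ' => Φ (z, τ')) =ᶠ[𝓝 τ] fun τ' => Ψ (z, τ') :=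
    (hc.continuousAt.eventually (hV.mem_nhds hp)).mono fun τ' hτ' => h hτ'
  exact he.deriv_eq.trans (hd _ hp).deriv

lemma analyticOnNhd_dFst {V : Set (ℂ × ℂ)} (hV : IsOpen V) {Φ : ℂ × ℂ → ℂ}
    (h : AnalyticOnNhd ℂ Φ V) : AnalyticOnNhd ℂ (dFst Φ) V := by
  have h1 : AnalyticOnNhd ℂ (fun p => fderiv ℂ Φ p (1, 0)) V := fun p hp =>
    ((ContinuousLinearMap.apply ℂ ℂ ((1 : ℂ), (0 : ℂ))).analyticAt _).fun_comp (h.fderiv p hp)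
  refine h1.congr hV fun p hp => ?_
  have h2 : HasDerivAt (fun z : ℂ => (z, p.2)) (1, 0) p.1 :=
    (hasDerivAt_id p.1).prodMk (hasDerivAt_const _ _)
  exact ((h p hp).differentiableAt.hasFDerivAt.comp_hasDerivAt p.1 h2).deriv.symm

lemma analyticOnNhd_dSnd {V : Set (ℂ × ℂ)} (hV : IsOpen V) {Φ : ℂ × ℂ → ℂ}
    (h : AnalyticOnNhd ℂ Φ V) : AnalyticOnNhd ℂ (dSnd Φ) V := by
  have h1 : AnalyticOnNhd ℂ (fun p => fderiv ℂ Φ p (0, 1)) V := fun p hp =>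
    ((ContinuousLinearMap.apply ℂ ℂ ((0 : ℂ), (1 : ℂ))).analyticAt _).fun_comp (h.fderiv p hp)
  refine h1.congr hV fun p hp => ?_
  have h2 : HasDerivAt (fun τ : ℂ => (p.1, τ)) (0, 1) p.2 :=
    (hasDerivAt_const _ _).prodMk (hasDerivAt_id p.2)
  exact ((h p hp).differentiableAt.hasFDerivAt.comp_hasDerivAt p.2 h2).deriv.symm

lemma analyticOnNhd_iterate {V : Set (ℂ × ℂ)} (hV : IsOpen V) {Φ : ℂ × ℂ → ℂ}
    (h : AnalyticOnNhd ℂ Φ V) (n m : ℕ) : AnalyticOnNhd ℂ (dFst^[n] (dSnd^[m] Φ)) V := by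
  have h1 : AnalyticOnNhd ℂ (dSnd^[m] Φ) V := by
    induction m with
    | zero => exact h
    | succ m ih => rw [Function.iterate_succ_apply']; exact analyticOnNhd_dSnd hV ih
  induction n with
  | zero => exact h1
  | succ n ih => rw [Function.iterate_succ_apply']; exact analyticOnNhd_dFst hV ih

/-- `Li_r(e ^ (2πiw))`, with `Li_0` replaced by its continuation to the complement of `ℤ`. -/
def expLi : ℕ → ℂ → ℂ
  | 0 => expGeom
  | r + 1 => expPolylog (r + 1)

lemma hasDerivAt_expLi (r : ℕ) {w : ℂ} (hw : w ∈ upper) :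
    HasDerivAt (expLi (r + 1)) (2 * Real.pi * Complex.I * expLi r w) w := by
  cases r with
  | zero => exact hasDerivAt_expPolylog_one hw
  | succ r => exact hasDerivAt_expPolylog (r + 1) hw

/-- The general shape of the iterated partial derivatives of `f`. -/
def seriesWithPoly (r m : ℕ) (s β κ : ℂ) (P : ℂ → ℂ → ℂ) (p : ℂ × ℂ) : ℂ :=
  ((2 * Real.pi * Complex.I) ^ r)⁻¹ * (β * expLi r p.1 + latSeries (expLi r) m (-p.1) p.2
    + s * latSeries (expLi r) m p.1 p.2 + κ * latSeries (expLi r) m 0 p.2) + P p.1 p.2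

lemma mem_strip_latDomain {p : ℂ × ℂ} (hp : p ∈ strip) : 0 < p.1.im ∧ (p.1, p.2) ∈ latDomain upper ∧
    (-p.1, p.2) ∈ latDomain upper ∧ (0, p.2) ∈ latDomain upper := by
  have h1 : 0 < p.1.im := hp.1
  have h2 : p.1.im < p.2.im := hp.2
  have hτ : 0 < p.2.im := h1.trans h2
  exact ⟨h1, mem_latDomain_upper hτ h2, mem_latDomain_upper hτ (by simp; linarith),
    mem_latDomain_upper hτ (by simpa using hτ)⟩

/-- The shape is stable under $\partial_z$: the sign `s` flips and the $z$-free term `κ` disappears.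
The factor $2\pi i$ is absorbed by the prefactor as `r` drops. -/
lemma hasDerivAt_seriesWithPoly_fst (r m : ℕ) (s β κ : ℂ) {P P' : ℂ → ℂ → ℂ} {p : ℂ × ℂ}
    (hp : p ∈ strip) (hP : HasDerivAt (fun z => P z p.2) (P' p.1 p.2) p.1) :
    HasDerivAt (fun z => seriesWithPoly (r + 1) m s β κ P (z, p.2))
      (seriesWithPoly r m (-s) β 0 P' p) p.1 := by
  obtain ⟨h0, h1, h2, -⟩ := mem_strip_latDomain hp
  have H : UpperDecay (expLi (r + 1)) upper := upperDecay_expPolylog r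
  have d1 := H.hasDerivAt_latSeries_fst (fun w hw => hasDerivAt_expLi r hw) m h1
  have d2 := (H.hasDerivAt_latSeries_fst (fun w hw => hasDerivAt_expLi r hw) m h2).comp p.1
    (hasDerivAt_neg p.1)
  rw [latSeries_const_mul] at d1 d2
  have d := ((((((hasDerivAt_expLi r h0).const_mul β).fun_add d2).fun_add (d1.const_mul s)).add_const
    (κ * latSeries (expLi (r + 1)) m 0 p.2)).const_mul
    ((2 * Real.pi * Complex.I) ^ (r + 1))⁻¹).fun_add hP
  refine d.congr_deriv ?_
  have hc := Complex.two_pi_I_ne_zero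
  simp only [seriesWithPoly, pow_succ, mul_inv]
  field_simp
  ring

/-- Under $\partial_\tau$ the $\tau$-free term `β` disappears and each series gains a factor $n$. -/
lemma hasDerivAt_seriesWithPoly_snd (r m : ℕ) (s β κ : ℂ) {P P' : ℂ → ℂ → ℂ} {p : ℂ × ℂ}
    (hp : p ∈ strip) (hP : HasDerivAt (fun τ => P p.1 τ) (P' p.1 p.2) p.2) :
    HasDerivAt (fun τ => seriesWithPoly (r + 1) m s β κ P (p.1, τ))
      (seriesWithPoly r (m + 1) s 0 κ P' p) p.2 := by
  obtain ⟨-, h1, h2, h3⟩ := mem_strip_latDomain hp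
  have H : UpperDecay (expLi (r + 1)) upper := upperDecay_expPolylog r
  have d1 := H.hasDerivAt_latSeries_snd (fun w hw => hasDerivAt_expLi r hw) m h1
  have d2 := H.hasDerivAt_latSeries_snd (fun w hw => hasDerivAt_expLi r hw) m h2
  have d3 := H.hasDerivAt_latSeries_snd (fun w hw => hasDerivAt_expLi r hw) m h3
  rw [latSeries_const_mul] at d1 d2 d3
  have d := (((((hasDerivAt_const p.2 (β * expLi (r + 1) p.1)).fun_add d2).fun_add
    (d1.const_mul s)).fun_add (d3.const_mul κ)).const_mul
    ((2 * Real.pi * Complex.I) ^ (r + 1))⁻¹).fun_add hP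
  refine d.congr_deriv ?_
  have hc := Complex.two_pi_I_ne_zero
  simp only [seriesWithPoly, pow_succ, mul_inv]
  field_simp
  ring

lemma isOpen_strip : IsOpen strip :=
  (isOpen_lt continuous_const (Complex.continuous_im.comp continuous_fst)).inter
    (isOpen_lt (Complex.continuous_im.comp continuous_fst)
      (Complex.continuous_im.comp continuous_snd))

/-- $B_1=-\tfrac12$ and $B_2=\tfrac16$ produce $z^3/12$ and $-z^2\tau/24$; $B_3=0$, and the $B_4$
term cancels against that of $\mathcal{L}i_3(1,q)$, whose two equal series give `κ` $=-2$. -/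
lemma fSeries_eq_seriesWithPoly {p : ℂ × ℂ} (hp : p ∈ strip) :
    fSeries p.1 p.2 = seriesWithPoly 3 0 1 1 (-2) (fun z τ => z ^ 3 / 12 - z ^ 2 * τ / 24
      - ((2 * Real.pi * Complex.I) ^ 3)⁻¹ * polylog 3 1) p := by
  rw [fSeries_eq hp]
  have hb : bernoulli 3 = 0 := bernoulli_eq_zero_of_odd (by decide) (by norm_num)
  have hc := Complex.two_pi_I_ne_zero
  simp only [branchFun, seriesWithPoly, chi, Finset.sum_range_succ, Finset.sum_range_zero, expLi,
    hb, bernoulli_one, bernoulli_two, Nat.reduceAdd, zero_add]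
  simp [Nat.factorial]
  field_simp
  ring

lemma analyticOnNhd_seriesWithPoly (m : ℕ) (s β κ c : ℂ) :
    AnalyticOnNhd ℂ (seriesWithPoly 0 m s β κ fun _ _ => c) regularSet := by
  rw [← pairDomain_nonInt]
  rintro p ⟨h1, h2, h3⟩
  have H := upperDecay_expGeom
  exact (analyticAt_const.mul ((((analyticAt_const.mul (H.analyticAt_fst h1)).add
    (H.analyticAt_latSeries_neg m h3)).add (analyticAt_const.mul (H.analyticAt_latSeries m h2))).add
    (analyticAt_const.mul (H.analyticAt_latSeries_zero m h2.1)))).add analyticAt_const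

variable {U : Set (ℂ × ℂ)} {F : ℂ → ℂ → ℂ}

/-- The identity theorem on the connected domain: a formula proved on the strip persists when its
right side is analytic on all of `regularSet`. This is where independence of the branch comes from.
-/
lemma IsBranch.pd_eq_of_eqOn_strip (hF : IsBranch U F) {n m : ℕ} {Ψ : ℂ × ℂ → ℂ}
    (hΨ : AnalyticOnNhd ℂ Ψ regularSet)
    (h : EqOn (dFst^[n] (dSnd^[m] fun p => F p.1 p.2)) Ψ strip) {z τ : ℂ} (hz : (z, τ) ∈ U) :
    pd F n m z τ = Ψ (z, τ) := by
  obtain ⟨p₀, hp₀⟩ := strip_nonempty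
  rw [pd_eq_iterate]
  exact (analyticOnNhd_iterate hF.isOpen hF.analytic n m).eqOn_of_preconnected_of_eventuallyEq
    (hΨ.mono hF.subset_regularSet) hF.isConnected.isPreconnected (hF.strip_subset hp₀)
    (h.eventuallyEq_of_mem (isOpen_strip.mem_nhds hp₀)) hz

lemma IsBranch.eqOn_strip (hF : IsBranch U F) : EqOn (fun p => F p.1 p.2)
    (seriesWithPoly 3 0 1 1 (-2) (fun z τ => z ^ 3 / 12 - z ^ 2 * τ / 24
      - ((2 * Real.pi * Complex.I) ^ 3)⁻¹ * polylog 3 1)) strip :=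
  fun p hp => (hF.eq_series p hp).trans (fSeries_eq_seriesWithPoly hp)

lemma IsBranch.eqOn_strip_one (hF : IsBranch U F) : EqOn (dSnd fun p => F p.1 p.2)
    (seriesWithPoly 2 1 1 0 (-2) fun z _ => -z ^ 2 / 24) strip :=
  dSnd_eqOn isOpen_strip hF.eqOn_strip fun p hp => hasDerivAt_seriesWithPoly_snd 2 0 1 1 (-2) hp <|
    ((((hasDerivAt_id' p.2).const_mul (p.1 ^ 2)).div_const 24).const_sub
      (p.1 ^ 3 / 12)).sub_const _ |>.congr_deriv (by ring)

lemma IsBranch.eqOn_strip_two (hF : IsBranch U F) : EqOn (dSnd (dSnd fun p => F p.1 p.2))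
    (seriesWithPoly 1 2 1 0 (-2) fun _ _ => 0) strip :=
  dSnd_eqOn isOpen_strip hF.eqOn_strip_one fun _ hp =>
    hasDerivAt_seriesWithPoly_snd 1 1 1 0 (-2) hp (hasDerivAt_const _ _)

lemma IsBranch.pd_zero_three (hF : IsBranch U F) {z τ : ℂ} (hz : (z, τ) ∈ U) :
    pd F 0 3 z τ = seriesWithPoly 0 3 1 0 (-2) (fun _ _ => 0) (z, τ) :=
  hF.pd_eq_of_eqOn_strip (n := 0) (m := 3)
    (analyticOnNhd_seriesWithPoly _ _ _ _ _)
    (dSnd_eqOn isOpen_strip hF.eqOn_strip_two fun _ hp =>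
      hasDerivAt_seriesWithPoly_snd 0 2 1 0 (-2) (P' := fun _ _ => 0) hp (hasDerivAt_const _ _)) hz

lemma IsBranch.pd_one_two (hF : IsBranch U F) {z τ : ℂ} (hz : (z, τ) ∈ U) :
    pd F 1 2 z τ = seriesWithPoly 0 2 (-1) 0 0 (fun _ _ => 0) (z, τ) :=
  hF.pd_eq_of_eqOn_strip (n := 1) (m := 2)
    (analyticOnNhd_seriesWithPoly _ _ _ _ _)
    (dFst_eqOn isOpen_strip hF.eqOn_strip_two fun _ hp =>
      hasDerivAt_seriesWithPoly_fst 0 2 1 0 (-2) (P' := fun _ _ => 0) hp (hasDerivAt_const _ _)) hz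

lemma IsBranch.pd_two_one (hF : IsBranch U F) {z τ : ℂ} (hz : (z, τ) ∈ U) :
    pd F 2 1 z τ = seriesWithPoly 0 1 1 0 0 (fun _ _ => -1 / 12) (z, τ) := by
  have h1 := dFst_eqOn isOpen_strip hF.eqOn_strip_one
    (Ψ' := seriesWithPoly 1 1 (-1) 0 0 fun z _ => -z / 12) fun p hp =>
      hasDerivAt_seriesWithPoly_fst 1 1 1 0 (-2) hp <|
        (((hasDerivAt_id' p.1).fun_pow 2).fun_neg.div_const 24).congr_deriv (by push_cast; ring)
  have h2 := dFst_eqOn isOpen_strip h1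
    (Ψ' := seriesWithPoly 0 1 (-(-1)) 0 0 fun _ _ => -1 / 12) fun p hp =>
      hasDerivAt_seriesWithPoly_fst 0 1 (-1) 0 0 hp ((hasDerivAt_id' p.1).fun_neg.div_const 12)
  rw [neg_neg] at h2
  exact hF.pd_eq_of_eqOn_strip (n := 2) (m := 1)
    (analyticOnNhd_seriesWithPoly _ _ _ _ _) h2 hz

lemma IsBranch.pd_three_zero (hF : IsBranch U F) {z τ : ℂ} (hz : (z, τ) ∈ U) :
    pd F 3 0 z τ = seriesWithPoly 0 0 (-1) 1 0 (fun _ _ => 1 / 2) (z, τ) := by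
  have h1 := dFst_eqOn isOpen_strip hF.eqOn_strip
    (Ψ' := seriesWithPoly 2 0 (-1) 1 0 fun z τ => z ^ 2 / 4 - z * τ / 12) fun p hp =>
      hasDerivAt_seriesWithPoly_fst 2 0 1 1 (-2) hp <|
        ((((hasDerivAt_id' p.1).fun_pow 3).div_const 12).fun_sub
          ((((hasDerivAt_id' p.1).fun_pow 2).mul_const p.2).div_const 24)).sub_const _
          |>.congr_deriv (by push_cast; ring)
  have h2 := dFst_eqOn isOpen_strip h1
    (Ψ' := seriesWithPoly 1 0 (-(-1)) 1 0 fun z τ => z / 2 - τ / 12) fun p hp =>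
      hasDerivAt_seriesWithPoly_fst 1 0 (-1) 1 0 hp <|
        ((((hasDerivAt_id' p.1).fun_pow 2).div_const 4).fun_sub
          (((hasDerivAt_id' p.1).mul_const p.2).div_const 12)).congr_deriv (by push_cast; ring)
  rw [neg_neg] at h2
  have h3 := dFst_eqOn isOpen_strip h2
    (Ψ' := seriesWithPoly 0 0 (-1) 1 0 fun _ _ => 1 / 2) fun p hp =>
      hasDerivAt_seriesWithPoly_fst 0 0 1 1 0 hp
        (((hasDerivAt_id' p.1).div_const 2).sub_const _)
  exact hF.pd_eq_of_eqOn_strip (n := 3) (m := 0)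
    (analyticOnNhd_seriesWithPoly _ _ _ _ _) h3 hz

end PartialDerivatives

/-! ### Bilateral form of the third partial derivatives -/

section Bilateral

open Set

/-- As $n\to-\infty$, $g(z+n\tau)\to-1$; reflection shows that adding $1$ restores exponential
decay, hence `stepNeg` in `bilateralTerm`. -/
lemma expGeom_neg {w : ℂ} (hw : w ∈ nonInt) : expGeom (-w) = -1 - expGeom w := by
  have h := one_sub_exp_ne_zero hw
  have h0 := Complex.exp_ne_zero (2 * Real.pi * Complex.I * w)
  rw [expGeom, expGeom, mul_neg, Complex.exp_neg]
  have h' : Complex.exp (2 * Real.pi * Complex.I * w) - 1 ≠ 0 := fun h1 =>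
    h (by linear_combination -h1)
  have h'' : 1 - (Complex.exp (2 * Real.pi * Complex.I * w))⁻¹ ≠ 0 := by
    rw [show 1 - (Complex.exp (2 * Real.pi * Complex.I * w))⁻¹ =
      (Complex.exp (2 * Real.pi * Complex.I * w) - 1) / Complex.exp (2 * Real.pi * Complex.I * w)
      by field_simp]
    exact div_ne_zero h' h0
  field_simp
  ring

/-- Equivalent, after clearing denominators, to multiplicativity of $1+1/g(w)=e^{-2\pi iw}$. -/
lemma expGeom_mul {u v : ℂ} (hu : u ∈ nonInt) (hv : v ∈ nonInt) (huv : u + v ∈ nonInt) :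
    expGeom u * expGeom v = expGeom (u + v) * (1 + expGeom u + expGeom v) := by
  have h1 := one_sub_exp_ne_zero hu
  have h2 := one_sub_exp_ne_zero hv
  have h3 := one_sub_exp_ne_zero huv
  have he : Complex.exp (2 * Real.pi * Complex.I * (u + v)) =
      Complex.exp (2 * Real.pi * Complex.I * u) * Complex.exp (2 * Real.pi * Complex.I * v) := by
    rw [mul_add, Complex.exp_add]
  simp only [expGeom]
  rw [he] at h3 ⊢
  field_simp
  ring

/-- The summands of the bilateral series attached to `(z, τ)`. -/
def bilateralTerm (τ z : ℂ) (n : ℤ) : ℂ := expGeom (z + n * τ) + stepNeg n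

variable {τ z x y : ℂ}

lemma add_int_mul_mem_nonInt (hz : z ∉ lattice τ) (n : ℤ) : z + n * τ ∈ nonInt :=
  fun m hm => hz ⟨m, -n, by push_cast; linear_combination hm⟩

lemma bilateralTerm_natCast_succ (n : ℕ) :
    bilateralTerm τ z ((n + 1 : ℕ) : ℤ) = expGeom (((n : ℂ) + 1) * τ - -z) := by
  rw [bilateralTerm, stepNeg, if_neg (by omega), add_zero]
  congr 1
  push_cast; ring

lemma bilateralTerm_neg_succ (hz : z ∉ lattice τ) (n : ℕ) :
    bilateralTerm τ z (-((n : ℤ) + 1)) = -expGeom (((n : ℂ) + 1) * τ - z) := by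
  have h1 := expGeom_neg (add_int_mul_mem_nonInt hz (-((n : ℤ) + 1)))
  have h2 : -(z + ((-((n : ℤ) + 1) : ℤ) : ℂ) * τ) = ((n : ℂ) + 1) * τ - z := by push_cast; ring
  rw [h2] at h1
  rw [bilateralTerm, stepNeg, if_pos (by omega), h1]
  ring

lemma mem_latDomain_nonInt (hτ : 0 < τ.im) (hz : z ∉ lattice τ) :
    (z, τ) ∈ latDomain nonInt ∧ (-z, τ) ∈ latDomain nonInt := by
  have h : (z, τ) ∈ pairDomain nonInt := by rw [pairDomain_nonInt]; exact ⟨hτ, hz⟩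
  exact h.2

lemma rapid_bilateralTerm (hτ : 0 < τ.im) (hz : z ∉ lattice τ) : Rapid (bilateralTerm τ z) := by
  obtain ⟨h1, h2⟩ := mem_latDomain_nonInt hτ hz
  have key : ∀ {z : ℂ}, (z, τ) ∈ latDomain nonInt → ∀ k : ℕ, Summable fun n : ℕ =>
      ((n : ℝ) + 1 + 1) ^ k * ‖expGeom (((n : ℂ) + 1) * τ - z)‖ := fun {z} hz k => by
    refine Summable.of_nonneg_of_le (fun n => by positivity) (fun n => ?_)
      -- The factor $2^k$ comes from $n+2\le2(n+1)$.
      ((upperDecay_expGeom.summable_norm k hz).mul_left (2 ^ k))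
    have hn : ‖(n : ℂ) + 1‖ = n + 1 := by exact_mod_cast Complex.norm_natCast (n + 1)
    rw [norm_mul, norm_pow, hn, ← mul_assoc, ← mul_pow]
    gcongr
    linarith [(Nat.cast_nonneg n : (0 : ℝ) ≤ n)]
  intro k
  refine Summable.of_nat_of_neg_add_one ?_ ?_
  · rw [← summable_nat_add_iff 1]
    refine (key h2 k).congr fun n => ?_
    rw [bilateralTerm_natCast_succ]
    congr 2
    push_cast
    rw [abs_of_nonneg (by positivity)]
  · refine (key h1 k).congr fun n => ?_
    rw [bilateralTerm_neg_succ hz, norm_neg]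
    congr 2
    push_cast
    rw [abs_neg, abs_of_nonneg (by positivity)]

/-- The factor $0^j$ belongs to the index $n=0$: with $0^0=1$ it keeps the isolated term exactly for
$j=0$, matching $f^{(3,0)}$. -/
lemma moment_bilateralTerm (hτ : 0 < τ.im) (hz : z ∉ lattice τ) (j : ℕ) :
    moment (bilateralTerm τ z) j = 0 ^ j * expGeom z + latSeries expGeom j (-z) τ
      - (-1) ^ j * latSeries expGeom j z τ := by
  obtain ⟨h1, h2⟩ := mem_latDomain_nonInt hτ hz
  have s1 := (upperDecay_expGeom.summable_norm j h1).of_norm.hasSum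
  have s2 := (upperDecay_expGeom.summable_norm j h2).of_norm.hasSum
  have e1 : HasSum (fun n : ℕ => ((n : ℤ) : ℂ) ^ j * bilateralTerm τ z n)
      (0 ^ j * expGeom z + latSeries expGeom j (-z) τ) := by
    have h := (hasSum_nat_add_iff (f := fun n : ℕ => ((n : ℤ) : ℂ) ^ j * bilateralTerm τ z n) 1
      (g := latSeries expGeom j (-z) τ)).mp (s2.congr_fun fun n => by
        rw [bilateralTerm_natCast_succ]; push_cast; rfl)
    rw [add_comm]
    simpa [bilateralTerm, stepNeg] using h
  have e2 : HasSum (fun n : ℕ => ((-((n : ℤ) + 1) : ℤ) : ℂ) ^ j *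
      bilateralTerm τ z (-((n : ℤ) + 1))) (-((-1) ^ j * latSeries expGeom j z τ)) :=
    (s1.mul_left ((-1) ^ j)).neg.congr_fun fun n => by
      rw [bilateralTerm_neg_succ hz]
      push_cast
      rw [neg_pow ((n : ℂ) + 1)]
      ring
  rw [sub_eq_add_neg]
  exact (HasSum.of_nat_of_neg_add_one (f := fun n : ℤ => (n : ℂ) ^ j * bilateralTerm τ z n)
    e1 e2).tsum_eq

lemma threeTerm_bilateralTerm (hx : x ∉ lattice τ) (hy : y ∉ lattice τ) (hxy : x + y ∉ lattice τ) :
    ThreeTerm (bilateralTerm τ x) (bilateralTerm τ y) (bilateralTerm τ (x + y)) := by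
  intro m n
  have e : x + m * τ + (y + n * τ) = x + y + ((m + n : ℤ) : ℂ) * τ := by push_cast; ring
  have h := expGeom_mul (add_int_mul_mem_nonInt hx m) (add_int_mul_mem_nonInt hy n)
    (by rw [e]; exact add_int_mul_mem_nonInt hxy (m + n))
  rw [e] at h
  -- Substituting $g=a-\text{step}$ in the addition law leaves only the identity `hs` between step
  -- functions.
  simp only [bilateralTerm]
  have hs : stepNeg (m + n) * (stepNeg m + stepNeg n - 1) = stepNeg m * stepNeg n := by
    unfold stepNeg
    split_ifs <;> first | omega | simp
  linear_combination h + hs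

/-- The left side is the Lambert series $\sum n^3q^n/(1-q^n)=\sum\sigma_3(n)q^n$. -/
lemma latSeries_expGeom_three_zero (τ : ℍ) :
    latSeries expGeom 3 0 τ = (ModularForm.E₄ τ - 1) / 240 := by
  have hq : ‖Complex.exp (2 * Real.pi * Complex.I * τ)‖ < 1 := norm_exp_two_pi_I_lt_one τ.im_pos
  have h1 := tsum_pow_div_one_sub_eq_tsum_sigma hq 3
  have hb : bernoulli 4 = -1 / 30 := by
    rw [bernoulli_eq_bernoulli'_of_ne_one (by norm_num), bernoulli'_four]
  have h2 := EisensteinSeries.q_expansion_bernoulli (k := 4) (by norm_num) (by decide) τ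
  simp only [zpow_natCast, Nat.add_one_sub_one, hb] at h2
  rw [← h1, tsum_pnat_eq_tsum_succ (f := fun n : ℕ => (n : ℂ) ^ 3 *
    Complex.exp (2 * Real.pi * Complex.I * τ) ^ n /
      (1 - Complex.exp (2 * Real.pi * Complex.I * τ) ^ n))] at h2
  have h3 : ∑' n : ℕ, ((n + 1 : ℕ) : ℂ) ^ 3 *
      Complex.exp (2 * Real.pi * Complex.I * τ) ^ (n + 1) /
      (1 - Complex.exp (2 * Real.pi * Complex.I * τ) ^ (n + 1)) = latSeries expGeom 3 0 τ := by
    refine tsum_congr fun n => ?_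
    have e : 2 * Real.pi * Complex.I * (((n : ℂ) + 1) * τ - 0) =
        ((n + 1 : ℕ) : ℂ) * (2 * Real.pi * Complex.I * τ) := by push_cast; ring
    rw [expGeom, e, Complex.exp_nat_mul, mul_div_assoc]
    push_cast
    rfl
  rw [h3] at h2
  have h4 : ModularForm.E₄ τ = 1 - 2 * 4 / (-1 / 30) * latSeries expGeom 3 0 τ := by
    rw [ModularForm.E₄, h2]
    push_cast
    rfl
  rw [h4]
  ring

variable {U : Set (ℂ × ℂ)} {F : ℂ → ℂ → ℂ}

lemma IsBranch.pd_three_zero_eq_moment (hF : IsBranch U F) (hz : (z, τ) ∈ U) :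
    pd F 3 0 z τ = 1 / 2 + moment (bilateralTerm τ z) 0 := by
  obtain ⟨hτ, hzτ⟩ := hF.subset_regularSet hz
  rw [hF.pd_three_zero hz, moment_bilateralTerm hτ hzτ, seriesWithPoly, expLi]
  ring

lemma IsBranch.pd_two_one_eq_moment (hF : IsBranch U F) (hz : (z, τ) ∈ U) :
    pd F 2 1 z τ = -1 / 12 + moment (bilateralTerm τ z) 1 := by
  obtain ⟨hτ, hzτ⟩ := hF.subset_regularSet hz
  rw [hF.pd_two_one hz, moment_bilateralTerm hτ hzτ, seriesWithPoly, expLi]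
  ring

lemma IsBranch.pd_one_two_eq_moment (hF : IsBranch U F) (hz : (z, τ) ∈ U) :
    pd F 1 2 z τ = moment (bilateralTerm τ z) 2 := by
  obtain ⟨hτ, hzτ⟩ := hF.subset_regularSet hz
  rw [hF.pd_one_two hz, moment_bilateralTerm hτ hzτ, seriesWithPoly, expLi]
  ring

lemma IsBranch.pd_zero_three_eq_moment {τ : ℍ} (hF : IsBranch U F) (hz : (z, (τ : ℂ)) ∈ U) :
    pd F 0 3 z τ = moment (bilateralTerm τ z) 3 - (ModularForm.E₄ τ - 1) / 120 := by
  obtain ⟨hτ, hzτ⟩ := hF.subset_regularSet hz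
  rw [hF.pd_zero_three hz, moment_bilateralTerm hτ hzτ, seriesWithPoly, expLi]
  linear_combination -2 * latSeries_expGeom_three_zero τ

end Bilateral

end EllipticTrilog

end

/-! ### The two identities for arbitrary branches -/

theorem mainTheorem4 (τ : ℍ) (x y : ℂ)
    (hx : x ∉ lattice τ) (hy : y ∉ lattice τ) (hxy : x + y ∉ lattice τ) :
    (∃ (U : Set (ℂ × ℂ)) (F : ℂ → ℂ → ℂ), IsBranch U F ∧
      (x, (τ : ℂ)) ∈ U ∧ (y, (τ : ℂ)) ∈ U ∧ (x + y, (τ : ℂ)) ∈ U) ∧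
    ∀ (U V W : Set (ℂ × ℂ)) (F G H : ℂ → ℂ → ℂ),
      IsBranch U F → IsBranch V G → IsBranch W H →
      (x, (τ : ℂ)) ∈ U → (y, (τ : ℂ)) ∈ V → (x + y, (τ : ℂ)) ∈ W →
      (pd H 3 0 (x + y) τ * (pd F 2 1 x τ - pd G 2 1 y τ)
          + pd G 3 0 y τ * (pd H 2 1 (x + y) τ - pd F 2 1 x τ)
          + (pd F 1 2 x τ - 1 / 2 * pd G 1 2 y τ + 1 / 2 * pd H 1 2 (x + y) τ) = 0) ∧
      ((pd F 3 0 x τ * (pd H 1 2 (x + y) τ - pd G 1 2 y τ)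
          + pd G 3 0 y τ * (pd H 1 2 (x + y) τ - pd F 1 2 x τ)
          - 2 / 3 * (pd H 3 0 (x + y) τ * (pd F 1 2 x τ + pd G 1 2 y τ)))
        + (2 / 3 * (pd H 2 1 (x + y) τ * pd F 2 1 x τ)
          + 2 / 3 * (pd H 2 1 (x + y) τ * pd G 2 1 y τ)
          - 8 / 3 * (pd F 2 1 x τ * pd G 2 1 y τ))
        + 10 / 9 * pd H 0 3 (x + y) τ + 1 / 108 * ModularForm.E₄ τ = 0) := by
  have hτ : 0 < (τ : ℂ).im := τ.im_pos
  constructor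
  · obtain ⟨U, F, hF, hU⟩ := exists_isBranch hτ (S := {x, y, x + y}) (Set.toFinite _).countable
      (by rintro z (rfl | rfl | rfl) <;> assumption)
    exact ⟨U, F, hF, hU x (by simp), hU y (by simp), hU (x + y) (by simp)⟩
  · intro U V W F G H hF hG hH hxU hyV hxyW
    have h := threeTerm_bilateralTerm hx hy hxy
    have ha := rapid_bilateralTerm hτ hx
    have hb := rapid_bilateralTerm hτ hy
    have hw := rapid_bilateralTerm hτ hxy
    rw [hF.pd_three_zero_eq_moment hxU, hG.pd_three_zero_eq_moment hyV,
      hH.pd_three_zero_eq_moment hxyW, hF.pd_two_one_eq_moment hxU, hG.pd_two_one_eq_moment hyV,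
      hH.pd_two_one_eq_moment hxyW, hF.pd_one_two_eq_moment hxU, hG.pd_one_two_eq_moment hyV,
      hH.pd_one_two_eq_moment hxyW, hH.pd_zero_three_eq_moment hxyW]
    -- Since $\tfrac{10}9\cdot\tfrac1{120}=\tfrac1{108}$, the $E_4$ inside $f^{(0,3)}$ cancels the
    -- explicit one and leaves the constant $\tfrac1{108}$.
    exact ⟨h.first_identity ha hb hw, by linear_combination h.second_identity ha hb hw⟩
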